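/- Let $d_0\in\{-1,2\}$, so that $\mathbb{Z}[\sqrt{d_0}]$ is $\mathbb{Z}[i]$ or $\mathbb{Z}[\sqrt2]$; write $\overline{w}$ for the conjugate of $w$ and $\mathrm{Norm}(w)=w\overline{w}$. Call $w=a+b\sqrt{d_0}$ odd if $\mathrm{Norm}(w)$ is odd, and primitive if it is odd and $\gcd(a,b)=1$. For an element $a$ and a nonzero prime ideal $\mathfrak p$ of odd norm, let $\left(\frac{a}{\mathfrak p}\right)$ be $0$ if $a\in\mathfrak p$, $1$ if $a\notin\mathfrak p$ is a square modulo $\mathfrak p$, and $-1$ otherwise, and let $\left(\frac{a}{\mathfrak a}\right)=\prod_{\mathfrak p^k\|\mathfrak a}\left(\frac{a}{\mathfrak p}\right)^k$ for an ideal $\mathfrak a$ of odd norm. For odd $w$ and any $z$ put $$\gamma(w,z)=\left(\frac{\overline{w}\,\overline{z}}{(w)}\right).$$ For real $M>0$ and $\Delta>0$ let $\mathcal R(M)$ be the set of odd $w$ with $M<\mathrm{Norm}(w)\le M(1+\Delta)$ such that: if $d_0=-1$, then $w\equiv 1 \bmod (1+i)^3$; if $d_0=2$, then $w$ or $-w$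 has the form $u+v\sqrt2$ with $u>0$ and $-u<2v\le u$. For complex sequences $\alpha=\{\alpha_w\}$ and $\beta=\{\beta_z\}$ indexed by the nonzero elements of $\mathbb{Z}[\sqrt{d_0}]$, put $$B_0(M,N;\Delta,\alpha,\beta)=\sum_{\substack{w\in\mathcal R(M)\\ w\text{ primitive}}}\ \sum_{\substack{z\in\mathcal R(N)\\ z\text{ primitive}}}\alpha_w\,\beta_z\,\gamma(w,z).$$ Proposition. For every real $K$ there is a constant $C>0$, depending only on $K$ (and $d_0$), such that the following holds. Let $f\ge 0$ be an integer, and let $\alpha$, $\beta$ be sequences as above, bounded in absolute value by $K$ and supported on elements that have at most $f$ prime factors in $\mathbb{Z}[\sqrt{d_0}]$ (up to units, counted without multiplicity; in particular this allows every element with at most $f$ prime factors counted with multiplicity) and whose norm is $\equiv 1\bmod 8$. Then for all real $M,N>1$ and $\Delta\in(0,1)$ with $\Delta M\ge 1$ and $\Delta N\ge 1$, $$\left|B_0(M,N;\Delta,\alpha,\beta)\right|\le C\cdot 2^f\,\Delta^{-\frac{11}{12}}\left(M^{-\frac1{12}}+N^{-\frac1{12}}\right)\Delta^2MN.$$ 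-/

import Mathlib

namespace QuadBilinear

open IsDedekindDomain

open Classical in
/-- The quadratic residue symbol `(a / 𝔭)` at a nonzero prime ideal `𝔭`. -/
noncomputable def primeSymbol {R : Type*} [CommRing R] (a : R) (v : HeightOneSpectrum R) : ℤ :=
  if a ∈ v.asIdeal then 0
  else if ∃ x : R, a - x ^ 2 ∈ v.asIdeal then 1
  else -1

/-- The quadratic residue symbol `(a / I)`: the product over the prime ideals dividing `I`,
with multiplicity, of the symbols at those primes. It is used for nonzero ideals of odd norm in
`ℤ[i]` and `ℤ[√2]` only, where all but finitely many factors are `1`. -/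
noncomputable def quadSymbol {R : Type*} [CommRing R] (a : R) (I : Ideal R) : ℤ :=
  ∏ᶠ v : HeightOneSpectrum R, primeSymbol a v ^ multiplicity v.asIdeal I

/-- The generalized Dirichlet symbol `γ(w, z) = (w̄ z̄ / (w))`, for `w` of odd norm. -/
noncomputable def gammaSymbol {d₀ : ℤ} (w z : Zsqrtd d₀) : ℤ :=
  quadSymbol (star w * star z) (Ideal.span {w})

/-- `w` has odd norm. -/
def IsOddElt {d₀ : ℤ} (w : Zsqrtd d₀) : Prop := Odd w.norm

/-- `w = a + b √d₀` is primitive: it is odd and `gcd (a, b) = 1`. -/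
def IsPrimitiveElt {d₀ : ℤ} (w : Zsqrtd d₀) : Prop := IsOddElt w ∧ IsCoprime w.re w.im

/-- In `ℤ[i]`, where `⟨1, 1⟩ = 1 + i`: `w ≡ 1 mod (1 + i) ^ 3`. -/
def IsPrimary {d₀ : ℤ} (w : Zsqrtd d₀) : Prop := (⟨1, 1⟩ : Zsqrtd d₀) ^ 3 ∣ w - 1

/-- `w = u + v √2` lies in the cone `u > 0`, `-u < 2 v ≤ u`, a fundamental domain for
multiplication by `3 + 2 √2` on the totally positive elements. -/
def InCone {d₀ : ℤ} (w : Zsqrtd d₀) : Prop := 0 < w.re ∧ -w.re < 2 * w.im ∧ 2 * w.im ≤ w.re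

/-- The choice of generators: primary elements of `ℤ[i]`; elements `w` of `ℤ[√2]` such that
`w` or `-w` is in the cone. -/
def IsNormalized {d₀ : ℤ} (w : Zsqrtd d₀) : Prop :=
  (d₀ = -1 ∧ IsPrimary w) ∨ (d₀ = 2 ∧ (InCone w ∨ InCone (-w)))

/-- The odd normalized elements with norm in `(M, M (1 + Δ)]`. -/
def normBoxSet (d₀ : ℤ) (M Δ : ℝ) : Set (Zsqrtd d₀) :=
  {w | IsOddElt w ∧ IsNormalized w ∧ M < (w.norm : ℝ) ∧ (w.norm : ℝ) ≤ M * (1 + Δ)}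

theorem normBoxSet_finite (d₀ : ℤ) (M Δ : ℝ) : (normBoxSet d₀ M Δ).Finite := by
  obtain ⟨B, hB⟩ := exists_nat_ge (M * (1 + Δ))
  have hfin : ((fun p : ℤ × ℤ => (⟨p.1, p.2⟩ : Zsqrtd d₀)) ''
      (Set.Icc (-(2 * B : ℤ)) (2 * B) ×ˢ Set.Icc (-(2 * B : ℤ)) (2 * B))).Finite :=
    ((Set.finite_Icc _ _).prod (Set.finite_Icc _ _)).image _
  refine hfin.subset ?_
  rintro ⟨a, b⟩ ⟨-, hn, -, hle⟩
  have hle' : Zsqrtd.norm (⟨a, b⟩ : Zsqrtd d₀) ≤ (B : ℤ) := by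
    exact_mod_cast hle.trans hB
  have key : a ^ 2 ≤ 2 * B ∧ b ^ 2 ≤ 2 * B := by
    rcases hn with ⟨rfl, -⟩ | ⟨rfl, h⟩
    · simp only [Zsqrtd.norm] at hle'
      constructor <;> nlinarith [sq_nonneg a, sq_nonneg b]
    · simp only [Zsqrtd.norm] at hle'
      simp only [InCone, Zsqrtd.re_neg, Zsqrtd.im_neg] at h
      have h4 : 4 * b ^ 2 ≤ a ^ 2 := by
        rcases h with ⟨h1, h2, h3⟩ | ⟨h1, h2, h3⟩ <;> nlinarith
      constructor <;> nlinarith [sq_nonneg a, sq_nonneg b]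
  obtain ⟨ha, hb⟩ := key
  refine ⟨(a, b), ⟨⟨?_, ?_⟩, ⟨?_, ?_⟩⟩, rfl⟩ <;> dsimp only <;> nlinarith

/-- The finite set `𝓡(M)` of odd normalized elements with norm in `(M, M (1 + Δ)]`. -/
noncomputable def normBox (d₀ : ℤ) (M Δ : ℝ) : Finset (Zsqrtd d₀) :=
  (normBoxSet_finite d₀ M Δ).toFinset

open Classical in
/-- The bilinear sum of `α_w β_z γ(w, z)` over primitive `w ∈ 𝓡(M)` and primitive `z ∈ 𝓡(N)`. -/
noncomputable def bilinearSum {d₀ : ℤ} (M N Δ : ℝ) (α β : Zsqrtd d₀ → ℂ) : ℂ :=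
  ∑ w ∈ (normBox d₀ M Δ).filter IsPrimitiveElt, ∑ z ∈ (normBox d₀ N Δ).filter IsPrimitiveElt,
    α w * β z * (gammaSymbol w z : ℂ)

/-- `w` has at most `f` prime factors; prime factors are identified with prime ideals
dividing `(w)` and are counted without multiplicity. -/
def AtMostPrimeFactors {d₀ : ℤ} (f : ℕ) (w : Zsqrtd d₀) : Prop :=
  {v : HeightOneSpectrum (Zsqrtd d₀) | v.asIdeal ∣ Ideal.span {w}}.encard ≤ f

/-- `α` is supported on elements with at most `f` prime factors and norm `≡ 1 mod 8`. -/
def IsAdmissible {d₀ : ℤ} (f : ℕ) (α : Zsqrtd d₀ → ℂ) : Prop :=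
  ∀ w : Zsqrtd d₀, w ≠ 0 → α w ≠ 0 → AtMostPrimeFactors f w ∧ w.norm ≡ 1 [ZMOD 8]

end QuadBilinear

/-!
# Bilinear sums of Dirichlet symbols over `ℤ[i]` and `ℤ[√2]`

The symbol `γ(w, z)` is first made explicit. If `w` is primitive of norm `n > 0`, then
`ℤ[√d] / (w) ≃ ℤ / n`, and symbols modulo `(w)` are Jacobi symbols modulo `n`
(`quadSymbol_eq_jacobiSym`). If moreover `n ≡ 1 mod 8`, then `γ(w, z)` is, up to the factor
`γ(w, 1)`, the Jacobi symbol `κ(w, z) = (r / Norm w)`, where `r` is the `√d`-coordinate of `w z`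
(`gammaSymbol_eq`). This kernel is multiplicative in `z` (`kernel_mul`) and periodic modulo `w̄`.
It is also symmetric (`kernel_comm`): `Norm w * Norm z = s ^ 2 - d r ^ 2` is a square modulo `r`, so
quadratic reciprocity over `ℤ` gives `(r / Norm w) (r / Norm z) = 1` unless both symbols vanish. By
symmetry one may assume `M ≤ N`.

The saving comes from a large sieve argument. The `k`-th power of the sum over `z` is a sum over
products `ζ = z₁ ⋯ z_k`, by multiplicativity. After an application of the Cauchy–Schwarz
inequality, positivity allows one to extend the summation to all `ζ` in a box of side
`L ≍ N ^ (k / 2)`, and there remain the sums over the box of `κ(v, ζ) κ(w, ζ)`, for pairs `(v, w)`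
(`norm_kernel_sum_pow_le`). If `Norm v * Norm w` is not a square, then the character takes the value
`-1` at some rational integer, and its sum over the box is `O(L M)`: compare the box with its
translates by a system of small residues modulo the conjugate of `v w`
(`abs_sum_box_le_of_periodic`). The remaining pairs number `O(M ^ (1 + ε))`
(`exists_card_isSquare_le`). The power `k = 1` suffices for
`N ≥ M ^ 3`, and `k = 4` for `M ≤ N ≤ M ^ 3`, where the divisor bound for the number of
representations `ζ = z₁ ⋯ z₄` loses only a small power of `M`.

This requires that the regions have area larger than their perimeter, which holds for
`Δ ≥ M ^ (-1 / 11)`. For smaller `Δ` the trivial bound is enough: `w` is counted by area and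
perimeter (`card_normBox_le`), and `z` by the fact that each norm is taken by `O(2 ^ f)` elements
with at most `f` prime factors (`card_le_two_pow_mul`). Only there does the factor `2 ^ f` arise.
-/

namespace QuadBilinear

open IsDedekindDomain

/-! ### The rings `ℤ[i]` and `ℤ[√2]` are principal ideal domains -/

theorem norm_ne_zero_of_ne_zero {d : ℤ} (hd : d = -1 ∨ d = 2) {w : Zsqrtd d} (hw : w ≠ 0) :
    w.norm ≠ 0 := by
  intro h
  refine hw ((Zsqrtd.norm_eq_zero (fun n hn => ?_) w).1 h)
  rcases hd with rfl | rfl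
  · nlinarith [mul_self_nonneg n]
  · have h1 : n ≤ 1 := by nlinarith
    have h2 : -1 ≤ n := by nlinarith
    interval_cases n <;> omega

theorem isDomain_zsqrtd {d : ℤ} (hd : d = -1 ∨ d = 2) : IsDomain (Zsqrtd d) := by
  have : NoZeroDivisors (Zsqrtd d) := by
    refine ⟨fun {a b} hab => ?_⟩
    by_contra! h
    have h1 := norm_ne_zero_of_ne_zero hd h.1
    have h2 := norm_ne_zero_of_ne_zero hd h.2
    have h3 : (a * b).norm = 0 := by rw [hab, Zsqrtd.norm_zero]
    rw [Zsqrtd.norm_mul] at h3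
    exact (mul_ne_zero h1 h2) h3
  exact NoZeroDivisors.to_isDomain _

theorem exists_two_mul_abs_sub_mul_le (u N : ℤ) (hN : N ≠ 0) : ∃ q : ℤ, 2 * |u - N * q| ≤ |N| := by
  refine ⟨round ((u : ℚ) / N), ?_⟩
  have h := abs_sub_round ((u : ℚ) / N)
  have hN' : (N : ℚ) ≠ 0 := by exact_mod_cast hN
  have h2 : |(u : ℚ) - N * round ((u : ℚ) / N)| = |(N : ℚ)| * |(u : ℚ) / N - round ((u : ℚ) / N)| := by
    rw [← abs_mul]; congr 1; field_simp
  have h3 : 2 * |(u : ℚ) - N * round ((u : ℚ) / N)| ≤ |(N : ℚ)| := by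
    rw [h2]; nlinarith [abs_nonneg (N : ℚ)]
  exact_mod_cast h3

/-- Division with rounding of both coordinates of `a / b = a b̄ / Norm b`. -/
theorem exists_rounded_quotient {d : ℤ} (hd : d = -1 ∨ d = 2) (a : Zsqrtd d) {b : Zsqrtd d}
    (hb : b ≠ 0) : ∃ q : Zsqrtd d, 2 * |((a - b * q) * star b).re| ≤ |b.norm| ∧
      2 * |((a - b * q) * star b).im| ≤ |b.norm| := by
  have hN := norm_ne_zero_of_ne_zero hd hb
  obtain ⟨x, hx⟩ := exists_two_mul_abs_sub_mul_le (a * star b).re b.norm hN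
  obtain ⟨y, hy⟩ := exists_two_mul_abs_sub_mul_le (a * star b).im b.norm hN
  have key : (a - b * ⟨x, y⟩) * star b = a * star b - (b.norm : Zsqrtd d) * ⟨x, y⟩ := by
    rw [Zsqrtd.norm_eq_mul_conj]; ring
  refine ⟨⟨x, y⟩, ?_, ?_⟩
  · rw [key, Zsqrtd.re_sub, Zsqrtd.re_smul]; exact hx
  · rw [key, Zsqrtd.im_sub, Zsqrtd.im_smul]; exact hy

theorem exists_norm_sub_mul_lt {d : ℤ} (hd : d = -1 ∨ d = 2) (a : Zsqrtd d) {b : Zsqrtd d}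
    (hb : b ≠ 0) : ∃ q : Zsqrtd d, (a - b * q).norm.natAbs < b.norm.natAbs := by
  obtain ⟨q, h1, h2⟩ := exists_rounded_quotient hd a hb
  refine ⟨q, ?_⟩
  have hN := norm_ne_zero_of_ne_zero hd hb
  have h3 : (a - b * q).norm * b.norm = ((a - b * q) * star b).norm := by
    rw [Zsqrtd.norm_mul, Zsqrtd.norm_conj]
  rw [Zsqrtd.norm_def ((a - b * q) * star b)] at h3
  set x := ((a - b * q) * star b).re
  set y := ((a - b * q) * star b).im
  have hx : 4 * (x * x) ≤ b.norm * b.norm := by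
    rw [← abs_mul_abs_self x, ← abs_mul_abs_self b.norm]; nlinarith [abs_nonneg x]
  have hy : 4 * (y * y) ≤ b.norm * b.norm := by
    rw [← abs_mul_abs_self y, ← abs_mul_abs_self b.norm]; nlinarith [abs_nonneg y]
  have hpos : 0 < b.norm * b.norm := mul_self_pos.2 hN
  have h4 : |(a - b * q).norm * b.norm| < b.norm * b.norm := by
    rw [h3, abs_lt]
    rcases hd with rfl | rfl <;> constructor <;> nlinarith [mul_self_nonneg x, mul_self_nonneg y]
  rw [abs_mul, ← abs_mul_abs_self b.norm] at h4
  have h5 := lt_of_mul_lt_mul_right h4 (abs_nonneg _)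
  rw [Int.abs_eq_natAbs, Int.abs_eq_natAbs] at h5
  exact_mod_cast h5

theorem isPrincipalIdealRing_zsqrtd {d : ℤ} (hd : d = -1 ∨ d = 2) :
    IsPrincipalIdealRing (Zsqrtd d) := by
  refine ⟨fun I => ?_⟩
  by_cases hI : I = ⊥
  · subst hI; exact ⟨0, by simp⟩
  obtain ⟨b₀, hb₀, hb₀'⟩ := Submodule.exists_mem_ne_zero_of_ne_bot hI
  have hex : ∃ n : ℕ, ∃ b ∈ I, b ≠ 0 ∧ b.norm.natAbs = n := ⟨_, b₀, hb₀, hb₀', rfl⟩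
  classical
  obtain ⟨b, hbI, hb0, hbn⟩ := Nat.find_spec hex
  refine ⟨b, le_antisymm (fun a ha => ?_) ((Ideal.span_singleton_le_iff_mem I).2 hbI)⟩
  obtain ⟨q, hq⟩ := exists_norm_sub_mul_lt hd a hb0
  have hmem : a - b * q ∈ I := I.sub_mem ha (I.mul_mem_right _ hbI)
  by_cases hz : a - b * q = 0
  · rw [sub_eq_zero] at hz
    exact Ideal.mem_span_singleton.2 ⟨q, hz⟩
  · exact absurd ⟨_, hmem, hz, rfl⟩ (Nat.find_min hex (hbn ▸ hq))

theorem isDedekindDomain_zsqrtd {d : ℤ} (hd : d = -1 ∨ d = 2) : IsDedekindDomain (Zsqrtd d) := by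
  have := isDomain_zsqrtd hd
  have := isPrincipalIdealRing_zsqrtd hd
  infer_instance

/-- Every residue class modulo `b` has a representative whose coordinates are bounded by those
of `b`. -/
theorem exists_small_representative {d : ℤ} (hd : d = -1 ∨ d = 2) (a : Zsqrtd d) {b : Zsqrtd d}
    (hb : b ≠ 0) : ∃ q : Zsqrtd d, |(a - b * q).re| ≤ |b.re| + |b.im| ∧
      |(a - b * q).im| ≤ |b.re| + |b.im| := by
  obtain ⟨q, h1, h2⟩ := exists_rounded_quotient hd a hb
  refine ⟨q, ?_⟩
  have hN := abs_pos.2 (norm_ne_zero_of_ne_zero hd hb)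
  have h3 : (b.norm : Zsqrtd d) * (a - b * q) = ((a - b * q) * star b) * b := by
    rw [Zsqrtd.norm_eq_mul_conj]; ring
  set r := (a - b * q) * star b
  have hd' : |d| ≤ 2 := by rcases hd with rfl | rfl <;> norm_num
  have hre := congrArg Zsqrtd.re h3
  have him := congrArg Zsqrtd.im h3
  rw [Zsqrtd.re_smul, Zsqrtd.re_mul] at hre
  rw [Zsqrtd.im_smul, Zsqrtd.im_mul] at him
  have b1 := abs_nonneg b.re
  have b2 := abs_nonneg b.im
  have r1 := abs_nonneg r.re
  have r2 := abs_nonneg r.im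
  constructor
  · refine le_of_mul_le_mul_left ?_ hN
    calc |b.norm| * |(a - b * q).re| = |r.re * b.re + d * r.im * b.im| := by rw [← abs_mul, hre]
      _ ≤ |r.re| * |b.re| + |d| * |r.im| * |b.im| := by
          refine (abs_add_le _ _).trans_eq ?_; rw [abs_mul, abs_mul, abs_mul]
      _ ≤ |r.re| * |b.re| + 2 * |r.im| * |b.im| := by gcongr
      _ ≤ |b.norm| * (|b.re| + |b.im|) := by nlinarith
  · refine le_of_mul_le_mul_left ?_ hN
    calc |b.norm| * |(a - b * q).im| = |r.re * b.im + r.im * b.re| := by rw [← abs_mul, him]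
      _ ≤ |r.re| * |b.im| + |r.im| * |b.re| := by
          refine (abs_add_le _ _).trans_eq ?_; rw [abs_mul, abs_mul]
      _ ≤ |b.norm| * (|b.re| + |b.im|) := by nlinarith

/-! ### Primitive elements and the residue map to the integers -/

/-- The natural number `|Norm w|`. -/
def absNorm {d : ℤ} (w : Zsqrtd d) : ℕ := w.norm.natAbs

/-- The image `a + t b` of `a + b √d` under `√d ↦ t`. It is multiplicative modulo `t ^ 2 - d`. -/
def evalAt {d : ℤ} (t : ℤ) (z : Zsqrtd d) : ℤ := z.re + t * z.im

/-- `t` is a square root of `d` modulo `|Norm w|` for which `√d ↦ t` is the reduction map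
`ℤ[√d] → ℤ[√d] / (w) ≃ ℤ / |Norm w|`. -/
def IsResidueRoot {d : ℤ} (w : Zsqrtd d) (t : ℤ) : Prop :=
  (absNorm w : ℤ) ∣ evalAt t w ∧ (absNorm w : ℤ) ∣ t ^ 2 - d

theorem absNorm_mul {d : ℤ} (w z : Zsqrtd d) : absNorm (w * z) = absNorm w * absNorm z := by
  rw [absNorm, Zsqrtd.norm_mul, Int.natAbs_mul]; rfl

theorem absNorm_star {d : ℤ} (w : Zsqrtd d) : absNorm (star w) = absNorm w := by
  rw [absNorm, Zsqrtd.norm_conj]; rfl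

theorem absNorm_dvd_iff {d : ℤ} {w : Zsqrtd d} {k : ℤ} : (absNorm w : ℤ) ∣ k ↔ w.norm ∣ k :=
  Int.natAbs_dvd

theorem absNorm_eq_one_iff {d : ℤ} {w : Zsqrtd d} : absNorm w = 1 ↔ IsUnit w :=
  Zsqrtd.norm_eq_one_iff

theorem IsOddElt.odd_absNorm {d : ℤ} {w : Zsqrtd d} (h : IsOddElt w) : Odd (absNorm w) :=
  Int.natAbs_odd.2 h

theorem IsOddElt.absNorm_ne_zero {d : ℤ} {w : Zsqrtd d} (h : IsOddElt w) : absNorm w ≠ 0 := by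
  intro h0
  have h1 := h.odd_absNorm
  rw [h0] at h1
  exact absurd h1 (by decide)

theorem IsOddElt.ne_zero {d : ℤ} {w : Zsqrtd d} (h : IsOddElt w) : w ≠ 0 := by
  rintro rfl
  exact h.absNorm_ne_zero (by simp [absNorm])

theorem evalAt_mul_sub {d : ℤ} (t : ℤ) (u v : Zsqrtd d) :
    evalAt t u * evalAt t v - evalAt t (u * v) = (t ^ 2 - d) * (u.im * v.im) := by
  simp only [evalAt, Zsqrtd.re_mul, Zsqrtd.im_mul]; ring

theorem evalAt_sub {d : ℤ} (t : ℤ) (u v : Zsqrtd d) :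
    evalAt t (u - v) = evalAt t u - evalAt t v := by
  simp only [evalAt, Zsqrtd.re_sub, Zsqrtd.im_sub]; ring

theorem evalAt_intCast {d : ℤ} (t r : ℤ) : evalAt t (r : Zsqrtd d) = r := by
  simp [evalAt]

theorem evalAt_mul_modEq {d t n : ℤ} (h : n ∣ t ^ 2 - d) (u v : Zsqrtd d) :
    evalAt t (u * v) ≡ evalAt t u * evalAt t v [ZMOD n] :=
  Int.modEq_iff_dvd.2 (by rw [evalAt_mul_sub]; exact h.mul_right _)

theorem jacobiSym_congr {a b : ℤ} {n : ℕ} (h : a ≡ b [ZMOD n]) : jacobiSym a n = jacobiSym b n :=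
  jacobiSym.mod_left' h

theorem IsPrimitiveElt.of_dvd {d : ℤ} {w v : Zsqrtd d} (hw : IsPrimitiveElt w) (h : v ∣ w) :
    IsPrimitiveElt v := by
  refine ⟨?_, Zsqrtd.isCoprime_of_dvd_isCoprime hw.2 h⟩
  obtain ⟨u, rfl⟩ := h
  have h1 := hw.1
  rw [IsOddElt, Zsqrtd.norm_mul] at h1
  exact (Int.odd_mul.1 h1).1

theorem IsPrimitiveElt.star {d : ℤ} {w : Zsqrtd d} (hw : IsPrimitiveElt w) :
    IsPrimitiveElt (star w) := by
  refine ⟨?_, ?_⟩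
  · have := hw.1
    rwa [IsOddElt, ← Zsqrtd.norm_conj] at this
  · simpa using hw.2.neg_right

theorem IsPrimitiveElt.isCoprime_im {d : ℤ} {w : Zsqrtd d} (hw : IsPrimitiveElt w) :
    IsCoprime w.im w.norm := by
  have h : w.norm = w.re * w.re + w.im * (-d * w.im) := by rw [Zsqrtd.norm_def]; ring
  rw [h]
  exact IsCoprime.add_mul_left_right (hw.2.symm.mul_right hw.2.symm) _

theorem IsPrimitiveElt.exists_isResidueRoot {d : ℤ} {w : Zsqrtd d} (hw : IsPrimitiveElt w) :
    ∃ t : ℤ, IsResidueRoot w t := by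
  obtain ⟨x, y, hxy⟩ := hw.isCoprime_im
  have hn : w.norm = w.re * w.re - d * w.im * w.im := Zsqrtd.norm_def w
  have h1 : w.norm ∣ evalAt (-(x * w.re)) w :=
    ⟨w.re * y, by rw [evalAt]; linear_combination -w.re * hxy⟩
  refine ⟨-(x * w.re), absNorm_dvd_iff.2 h1, absNorm_dvd_iff.2 ?_⟩
  -- `b² (t² - d) ≡ a² - d b² = Norm w`, and `b` is invertible modulo `Norm w`.
  refine (hw.isCoprime_im.symm.mul_right hw.isCoprime_im.symm).dvd_of_dvd_mul_left ?_
  obtain ⟨k, hk⟩ := h1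
  refine ⟨1 + k * (-(x * w.re) * w.im - w.re), ?_⟩
  rw [evalAt] at hk
  linear_combination (-(x * w.re) * w.im - w.re) * hk - hn

/-- A residue root for `w` is one for every divisor of `w`. -/
theorem IsResidueRoot.of_dvd {d : ℤ} {w v : Zsqrtd d} {t : ℤ} (ht : IsResidueRoot w t)
    (hw : IsPrimitiveElt w) (h : v ∣ w) : IsResidueRoot v t := by
  have hv := hw.of_dvd h
  obtain ⟨s, hs⟩ := hv.exists_isResidueRoot
  have hdvd : (absNorm v : ℤ) ∣ absNorm w := by
    obtain ⟨u, rfl⟩ := h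
    rw [absNorm_mul]; push_cast; exact dvd_mul_right _ _
  have h1 : (absNorm v : ℤ) ∣ evalAt s w := by
    obtain ⟨u, rfl⟩ := h
    have h2 := evalAt_mul_modEq hs.2 v u
    exact (Int.ModEq.dvd_iff h2).2 (hs.1.mul_right _)
  have h3 : (absNorm v : ℤ) ∣ w.im * (t - s) := by
    have e : w.im * (t - s) = evalAt t w - evalAt s w := by simp only [evalAt]; ring
    rw [e]
    exact dvd_sub (hdvd.trans ht.1) h1
  have hco : IsCoprime (absNorm v : ℤ) w.im := by
    refine (hw.isCoprime_im.of_isCoprime_of_dvd_right ?_).symm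
    exact hdvd.trans (Int.natAbs_dvd_natAbs.1 (by simp [absNorm]))
  have h4 : (absNorm v : ℤ) ∣ t - s := hco.dvd_of_dvd_mul_left h3
  refine ⟨?_, hdvd.trans ht.2⟩
  have e : evalAt t v = evalAt s v + (t - s) * v.im := by simp only [evalAt]; ring
  rw [e]
  exact dvd_add hs.1 (h4.mul_right v.im)

/-! ### The residue symbol as a Jacobi symbol -/

/-- The norm of a primitive irreducible element is, up to sign, a rational prime. -/
theorem prime_absNorm_of_irreducible {d : ℤ} (hd : d = -1 ∨ d = 2) {π : Zsqrtd d}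
    (hprim : IsPrimitiveElt π) (hπ : Irreducible π) : (absNorm π).Prime := by
  have := isDomain_zsqrtd hd
  have := isPrincipalIdealRing_zsqrtd hd
  have hp : Prime π := hπ.prime
  have hdiv : π ∣ ((absNorm π : ℕ) : Zsqrtd d) := by
    have h1 : π ∣ ((π.norm : ℤ) : Zsqrtd d) := ⟨_, Zsqrtd.norm_eq_mul_conj π⟩
    have h2 : ((π.norm : ℤ) : Zsqrtd d) ∣ ((absNorm π : ℕ) : Zsqrtd d) := by
      rw [← Int.cast_natCast, Zsqrtd.intCast_dvd_intCast]
      exact Int.dvd_natAbs.2 dvd_rfl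
    exact h1.trans h2
  rw [← Nat.prod_primeFactorsList hprim.1.absNorm_ne_zero, Nat.cast_list_prod] at hdiv
  obtain ⟨q, hq, hqd⟩ := (Prime.dvd_prod_iff hp).1 hdiv
  obtain ⟨p, hpmem, rfl⟩ := List.mem_map.1 hq
  have hpp := Nat.prime_of_mem_primeFactorsList hpmem
  obtain ⟨η, hη⟩ := hqd
  have hmul : absNorm π * absNorm η = p ^ 2 := by
    rw [← absNorm_mul, ← hη, absNorm, Zsqrtd.norm_natCast]
    rw [← Nat.cast_mul, Int.natAbs_natCast, sq]
  obtain ⟨i, hi, hpi⟩ := (Nat.dvd_prime_pow hpp).1 ⟨_, hmul.symm⟩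
  have hne : absNorm π ≠ 1 := fun h => hπ.not_isUnit (absNorm_eq_one_iff.1 h)
  interval_cases i
  · exact absurd hpi hne
  · rw [hpi, pow_one]; exact hpp
  · exfalso
    have h1 : absNorm η = 1 := by
      rw [hpi] at hmul
      exact Nat.eq_of_mul_eq_mul_left (pow_pos hpp.pos 2) (by simpa using hmul)
    obtain ⟨u, hu⟩ := absNorm_eq_one_iff.1 h1
    have h2 : ((p : ℤ) : Zsqrtd d) ∣ π := by
      refine ⟨(u⁻¹ : (Zsqrtd d)ˣ), ?_⟩
      rw [Int.cast_natCast, hη, ← hu, mul_assoc, Units.mul_inv, mul_one]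
    obtain ⟨h3, h4⟩ := (Zsqrtd.intCast_dvd _ _).1 h2
    have h5 := hprim.2.isUnit_of_dvd' h3 h4
    exact hpp.one_lt.ne' (by simpa using Int.isUnit_iff_natAbs_eq.1 h5)

/-- Divisibility by a primitive irreducible element is read off from the residue map. -/
theorem irreducible_dvd_iff {d : ℤ} (hd : d = -1 ∨ d = 2) {π : Zsqrtd d}
    (hprim : IsPrimitiveElt π) (hπ : Irreducible π) {t : ℤ} (ht : IsResidueRoot π t)
    (a : Zsqrtd d) : π ∣ a ↔ (absNorm π : ℤ) ∣ evalAt t a := by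
  have := isDomain_zsqrtd hd
  have := isPrincipalIdealRing_zsqrtd hd
  have hpp := prime_absNorm_of_irreducible hd hprim hπ
  have hmul : ∀ u v : Zsqrtd d, (absNorm π : ℤ) ∣ evalAt t (u * v) ↔
      (absNorm π : ℤ) ∣ evalAt t u * evalAt t v := fun u v =>
    Int.ModEq.dvd_iff (evalAt_mul_modEq ht.2 u v)
  constructor
  · rintro ⟨v, rfl⟩
    exact (hmul _ _).2 (ht.1.mul_right _)
  · intro h
    by_contra hn
    obtain ⟨u, v, huv⟩ := (hπ.coprime_iff_not_dvd).2 hn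
    have h1 : evalAt t (u * π) + evalAt t (v * a) = 1 := by
      have : evalAt t (u * π) + evalAt t (v * a) = evalAt t (u * π + v * a) := by
        simp only [evalAt, Zsqrtd.re_add, Zsqrtd.im_add]; ring
      rw [this, huv]; simp [evalAt]
    have h2 : (absNorm π : ℤ) ∣ 1 := by
      rw [← h1]
      exact dvd_add ((hmul _ _).2 (ht.1.mul_left _)) ((hmul _ _).2 (h.mul_left _))
    exact hpp.one_lt.ne' (by exact_mod_cast Int.eq_one_of_dvd_one (by positivity) h2)

/-- The prime `(π)`. -/
def primeOfIrreducible {d : ℤ} (hd : d = -1 ∨ d = 2) (π : Zsqrtd d) (hπ : Irreducible π) :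
    HeightOneSpectrum (Zsqrtd d) where
  asIdeal := Ideal.span {π}
  isPrime := by
    have := isDomain_zsqrtd hd
    have := isPrincipalIdealRing_zsqrtd hd
    exact (Ideal.span_singleton_prime hπ.ne_zero).2 hπ.prime
  ne_bot := by simpa using hπ.ne_zero

theorem primeSymbol_primeOfIrreducible {d : ℤ} (hd : d = -1 ∨ d = 2) {π : Zsqrtd d}
    (hprim : IsPrimitiveElt π) (hπ : Irreducible π) {t : ℤ} (ht : IsResidueRoot π t)
    (a : Zsqrtd d) :
    primeSymbol a (primeOfIrreducible hd π hπ) = jacobiSym (evalAt t a) (absNorm π) := by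
  have hpp := prime_absNorm_of_irreducible hd hprim hπ
  have : Fact (absNorm π).Prime := ⟨hpp⟩
  have hmem : ∀ b : Zsqrtd d, b ∈ (primeOfIrreducible hd π hπ).asIdeal ↔
      ((evalAt t b : ℤ) : ZMod (absNorm π)) = 0 := fun b => by
    rw [ZMod.intCast_zmod_eq_zero_iff_dvd, ← irreducible_dvd_iff hd hprim hπ ht]
    exact Ideal.mem_span_singleton
  have hsq : (∃ x : Zsqrtd d, a - x ^ 2 ∈ (primeOfIrreducible hd π hπ).asIdeal) ↔
      IsSquare ((evalAt t a : ℤ) : ZMod (absNorm π)) := by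
    constructor
    · rintro ⟨x, hx⟩
      rw [hmem, evalAt_sub, Int.cast_sub, sub_eq_zero] at hx
      refine ⟨((evalAt t x : ℤ) : ZMod (absNorm π)), ?_⟩
      rw [hx, ← Int.cast_mul, ZMod.intCast_eq_intCast_iff, sq]
      exact evalAt_mul_modEq ht.2 x x
    · rintro ⟨y, hy⟩
      refine ⟨((y.val : ℤ) : Zsqrtd d), ?_⟩
      rw [hmem, evalAt_sub, ← Int.cast_pow, evalAt_intCast, Int.cast_sub, sub_eq_zero, hy]
      simp [sq]
  rw [primeSymbol, ← jacobiSym.legendreSym.to_jacobiSym]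
  split_ifs with h1 h2
  · exact ((legendreSym.eq_zero_iff _ _).2 ((hmem a).1 h1)).symm
  · exact ((legendreSym.eq_one_iff _ (fun h => h1 ((hmem a).2 h))).2 (hsq.1 h2)).symm
  · exact ((legendreSym.eq_neg_one_iff _).2 (fun h => h2 (hsq.2 h))).symm

theorem quadSymbol_top {d : ℤ} (hd : d = -1 ∨ d = 2) (a : Zsqrtd d) :
    quadSymbol a (⊤ : Ideal (Zsqrtd d)) = 1 := by
  have := isDomain_zsqrtd hd
  have := isDedekindDomain_zsqrtd hd
  rw [quadSymbol]
  refine finprod_eq_one_of_forall_eq_one fun v => ?_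
  rw [multiplicity_eq_zero.2, pow_zero]
  intro h
  rw [Ideal.dvd_iff_le] at h
  exact v.isPrime.ne_top (top_le_iff.1 h)

theorem finite_mulSupport_primeSymbol {d : ℤ} (hd : d = -1 ∨ d = 2) (a : Zsqrtd d)
    {I : Ideal (Zsqrtd d)} (hI : I ≠ 0) :
    (Function.mulSupport fun v : HeightOneSpectrum (Zsqrtd d) =>
      primeSymbol a v ^ multiplicity v.asIdeal I).Finite := by
  have := isDomain_zsqrtd hd
  have := isDedekindDomain_zsqrtd hd
  refine (Ideal.finite_factors hI).subset fun v hv => ?_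
  by_contra h
  exact hv (by dsimp only; rw [multiplicity_eq_zero.2 h, pow_zero])

theorem quadSymbol_mul {d : ℤ} (hd : d = -1 ∨ d = 2) (a : Zsqrtd d)
    {I J : Ideal (Zsqrtd d)} (hI : I ≠ 0) (hJ : J ≠ 0) :
    quadSymbol a (I * J) = quadSymbol a I * quadSymbol a J := by
  have := isDomain_zsqrtd hd
  have := isDedekindDomain_zsqrtd hd
  rw [quadSymbol, quadSymbol, quadSymbol, ← finprod_mul_distrib
    (finite_mulSupport_primeSymbol hd a hI) (finite_mulSupport_primeSymbol hd a hJ)]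
  refine finprod_congr fun v => ?_
  rw [multiplicity_mul v.prime, pow_add]
  exact FiniteMultiplicity.of_prime_left v.prime (mul_ne_zero hI hJ)

theorem quadSymbol_span_irreducible {d : ℤ} (hd : d = -1 ∨ d = 2) (a : Zsqrtd d)
    {π : Zsqrtd d} (hπ : Irreducible π) :
    quadSymbol a (Ideal.span {π}) = primeSymbol a (primeOfIrreducible hd π hπ) := by
  have := isDomain_zsqrtd hd
  have := isDedekindDomain_zsqrtd hd
  rw [quadSymbol, finprod_eq_single _ (primeOfIrreducible hd π hπ)]
  · have h : multiplicity (primeOfIrreducible hd π hπ).asIdeal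
        (primeOfIrreducible hd π hπ).asIdeal = 1 := multiplicity_self
    conv_lhs => rw [show Ideal.span {π} = (primeOfIrreducible hd π hπ).asIdeal from rfl]
    rw [h, pow_one]
  · intro v hv
    rw [multiplicity_eq_zero.2, pow_zero]
    intro h
    rw [Ideal.dvd_iff_le] at h
    have hmax := (primeOfIrreducible hd π hπ).isMaximal
    exact hv (HeightOneSpectrum.ext (hmax.eq_of_le v.isPrime.ne_top h).symm)

/-- For primitive `w` the symbol `(a / (w))` is the Jacobi symbol of the image of `a` in
`ℤ[√d] / (w) ≃ ℤ / |Norm w|`. -/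
theorem quadSymbol_eq_jacobiSym {d : ℤ} (hd : d = -1 ∨ d = 2) (a : Zsqrtd d) (t : ℤ) :
    ∀ (n : ℕ) (w : Zsqrtd d), absNorm w = n → IsPrimitiveElt w → IsResidueRoot w t →
      quadSymbol a (Ideal.span {w}) = jacobiSym (evalAt t a) (absNorm w) := by
  have := isDomain_zsqrtd hd
  have := isPrincipalIdealRing_zsqrtd hd
  intro n
  induction n using Nat.strong_induction_on with
  | _ n ih =>
    intro w hwn hw ht
    by_cases hu : IsUnit w
    · rw [Ideal.span_singleton_eq_top.2 hu, quadSymbol_top hd, absNorm_eq_one_iff.2 hu,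
        jacobiSym.one_right]
    · obtain ⟨π, hπ, v, rfl⟩ := WfDvdMonoid.exists_irreducible_factor hu hw.1.ne_zero
      have hπp := hw.of_dvd (Dvd.intro _ rfl)
      have hvp := hw.of_dvd (Dvd.intro_left _ rfl)
      have hpp := prime_absNorm_of_irreducible hd hπp hπ
      have hv0 := hvp.1.absNorm_ne_zero
      have hlt : absNorm v < n := by
        rw [← hwn, absNorm_mul]
        exact lt_mul_left (Nat.pos_of_ne_zero hv0) hpp.one_lt
      rw [← Ideal.span_singleton_mul_span_singleton, quadSymbol_mul hd,
        quadSymbol_span_irreducible hd a hπ,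
        primeSymbol_primeOfIrreducible hd hπp hπ (ht.of_dvd hw (Dvd.intro _ rfl)),
        ih _ hlt v rfl hvp (ht.of_dvd hw (Dvd.intro_left _ rfl)), absNorm_mul,
        jacobiSym.mul_right' _ hpp.ne_zero hv0]
      · simpa using hπ.ne_zero
      · simpa using hvp.1.ne_zero

/-! ### The symmetric kernel -/

/-- `w` is primitive, and its norm is positive and `≡ 1 mod 8`. -/
structure IsKernelElt {d : ℤ} (w : Zsqrtd d) : Prop where
  primitive : IsPrimitiveElt w
  norm_pos : 0 < w.norm
  norm_modEq : w.norm ≡ 1 [ZMOD 8]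

/-- The Jacobi symbol of the `√d`-coordinate of `w z` modulo `Norm w`. On elements with norm
`≡ 1 mod 8` it is a symmetric function, multiplicative in each variable, which agrees with
`γ(w, z)` up to a factor depending on `w` alone. -/
def kernel {d : ℤ} (w z : Zsqrtd d) : ℤ := jacobiSym (w * z).im (absNorm w)

theorem jacobiSym_two_pow_of_mod_eight {n : ℕ} (hn : n % 8 = 1) (e : ℕ) :
    jacobiSym (2 ^ e) n = 1 := by
  have hodd : Odd n := Nat.odd_iff.2 (by omega)
  have h8 : (n : ZMod 8) = 1 := by
    rw [← ZMod.natCast_mod, hn]; rfl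
  rw [jacobiSym.pow_left, jacobiSym.at_two hodd, h8, map_one, one_pow]

theorem jacobiSym_neg_of_mod_eight {n : ℕ} (hn : n % 8 = 1) (k : ℤ) :
    jacobiSym (-k) n = jacobiSym k n := by
  have hodd : Odd n := Nat.odd_iff.2 (by omega)
  have h4 : (n : ZMod 4) = 1 := by
    rw [← ZMod.natCast_mod, show n % 4 = 1 by omega]; rfl
  rw [jacobiSym.neg _ hodd, h4, map_one, one_mul]

/-- If `n ≡ 1 mod 8` is a square modulo `k`, then quadratic reciprocity gives `(k / n) = 1`; the
congruence takes care of the sign of `k` and of its power of `2`. -/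
theorem jacobiSym_eq_one_of_sq_sub {n : ℕ} (hn : n % 8 = 1) {k : ℤ} (hk : IsCoprime k n) {a : ℤ}
    (h : k ∣ n - a ^ 2) : jacobiSym k n = 1 := by
  have main : ∀ m : ℕ, IsCoprime (m : ℤ) n → (m : ℤ) ∣ n - a ^ 2 → jacobiSym m n = 1 := by
    intro m hm hd
    rcases eq_or_ne m 0 with rfl | hm0
    · have : n = 1 := by
        have := isCoprime_zero_left.1 hm
        simpa using Int.isUnit_iff_natAbs_eq.1 this
      rw [this, jacobiSym.one_right]
    obtain ⟨e, l, hl, rfl⟩ := Nat.exists_eq_two_pow_mul_odd hm0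
    push_cast at hm hd
    rw [Nat.cast_mul, jacobiSym.mul_left, Nat.cast_pow, Nat.cast_ofNat,
      jacobiSym_two_pow_of_mod_eight hn, one_mul,
      ← jacobiSym.quadratic_reciprocity_one_mod_four (by omega) hl]
    have hmod : (n : ℤ) ≡ a ^ 2 [ZMOD l] :=
      (Int.modEq_iff_dvd.2 ((Dvd.intro_left _ rfl).trans hd)).symm
    have hco : IsCoprime (n : ℤ) l := hm.of_mul_left_right.symm
    rw [jacobiSym_congr hmod]
    refine jacobiSym.sq_one' (Int.isCoprime_iff_gcd_eq_one.1 ?_)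
    obtain ⟨u, hu⟩ := hmod.dvd
    refine IsCoprime.of_isCoprime_of_dvd_left ?_ (dvd_pow_self a two_ne_zero)
    have : a ^ 2 = n + l * u := by linear_combination hu
    rw [this]
    exact hco.add_mul_left_left u
  rcases Int.natAbs_eq k with h1 | h1
  · rw [h1] at hk h ⊢
    exact main _ hk h
  · rw [h1] at hk h ⊢
    rw [jacobiSym_neg_of_mod_eight hn]
    exact main _ (by simpa using hk.neg_left) ((neg_dvd).1 h)

theorem IsKernelElt.natCast_absNorm {d : ℤ} {w : Zsqrtd d} (hw : IsKernelElt w) :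
    (absNorm w : ℤ) = w.norm := Int.natAbs_of_nonneg hw.norm_pos.le

theorem IsKernelElt.absNorm_mod {d : ℤ} {w : Zsqrtd d} (hw : IsKernelElt w) :
    absNorm w % 8 = 1 := by
  have h1 := hw.norm_modEq
  rw [← hw.natCast_absNorm, Int.ModEq] at h1
  omega

theorem IsKernelElt.absNorm_pos {d : ℤ} {w : Zsqrtd d} (hw : IsKernelElt w) : 0 < absNorm w :=
  Nat.pos_of_ne_zero hw.primitive.1.absNorm_ne_zero

theorem IsKernelElt.jacobiSym_im {d : ℤ} {w : Zsqrtd d} (hw : IsKernelElt w) :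
    jacobiSym w.im (absNorm w) = 1 := by
  refine jacobiSym_eq_one_of_sq_sub hw.absNorm_mod (a := w.re) ?_ ?_
  · rw [hw.natCast_absNorm]; exact hw.primitive.isCoprime_im
  · rw [hw.natCast_absNorm, Zsqrtd.norm_def]
    exact ⟨-d * w.im, by ring⟩

/-- The kernel is the Jacobi symbol of the residue of `z` modulo `w̄`. -/
theorem kernel_eq_evalAt {d : ℤ} {w : Zsqrtd d} (hw : IsKernelElt w) {s : ℤ}
    (hs : IsResidueRoot (star w) s) (z : Zsqrtd d) :
    kernel w z = jacobiSym (evalAt s z) (absNorm w) := by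
  have h1 : (absNorm w : ℤ) ∣ evalAt s (star w) := by rw [← absNorm_star]; exact hs.1
  have h2 : (w * z).im ≡ w.im * evalAt s z [ZMOD absNorm w] := by
    rw [Int.modEq_iff_dvd]
    have e : w.im * evalAt s z - (w * z).im = -(evalAt s (star w) * z.im) := by
      simp only [evalAt, Zsqrtd.im_mul, Zsqrtd.re_star, Zsqrtd.im_star]; ring
    rw [e]
    exact (h1.mul_right _).neg_right
  rw [kernel, jacobiSym_congr h2, jacobiSym.mul_left, hw.jacobiSym_im, one_mul]

theorem kernel_mul {d : ℤ} {w : Zsqrtd d} (hw : IsKernelElt w) (y z : Zsqrtd d) :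
    kernel w (y * z) = kernel w y * kernel w z := by
  obtain ⟨s, hs⟩ := hw.primitive.star.exists_isResidueRoot
  have h2 := hs.2
  rw [absNorm_star] at h2
  rw [kernel_eq_evalAt hw hs, kernel_eq_evalAt hw hs, kernel_eq_evalAt hw hs,
    ← jacobiSym.mul_left, jacobiSym_congr (evalAt_mul_modEq h2 y z)]

theorem kernel_intCast {d : ℤ} {w : Zsqrtd d} (hw : IsKernelElt w) (r : ℤ) :
    kernel w (r : Zsqrtd d) = jacobiSym r (absNorm w) := by
  obtain ⟨s, hs⟩ := hw.primitive.star.exists_isResidueRoot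
  rw [kernel_eq_evalAt hw hs, evalAt_intCast]

theorem kernel_prod {d : ℤ} {w : Zsqrtd d} (hw : IsKernelElt w) {ι : Type*} (s : Finset ι)
    (g : ι → Zsqrtd d) : kernel w (∏ i ∈ s, g i) = ∏ i ∈ s, kernel w (g i) := by
  let φ : Zsqrtd d →* ℤ :=
    { toFun := kernel w
      map_one' := by
        have := kernel_intCast hw 1
        rwa [Int.cast_one, jacobiSym.one_left] at this
      map_mul' := kernel_mul hw }
  exact map_prod φ g s

theorem kernel_add_mul_star {d : ℤ} {w : Zsqrtd d} (hw : IsKernelElt w) (z u : Zsqrtd d) :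
    kernel w (z + star w * u) = kernel w z := by
  rw [kernel, kernel, mul_add, ← mul_assoc, ← Zsqrtd.norm_eq_mul_conj, Zsqrtd.im_add,
    Zsqrtd.im_smul, ← hw.natCast_absNorm]
  exact jacobiSym_congr (by simp [Int.ModEq])

theorem abs_jacobiSym_le_one (a : ℤ) (n : ℕ) : |jacobiSym a n| ≤ 1 := by
  rcases jacobiSym.trichotomy a n with h | h | h <;> simp [h]

theorem abs_kernel_le_one {d : ℤ} (w z : Zsqrtd d) : |kernel w z| ≤ 1 := abs_jacobiSym_le_one _ _

theorem gammaSymbol_eq {d : ℤ} (hd : d = -1 ∨ d = 2) {w : Zsqrtd d} (hw : IsKernelElt w)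
    (z : Zsqrtd d) : gammaSymbol w z = gammaSymbol w 1 * kernel w z := by
  obtain ⟨t, ht⟩ := hw.primitive.exists_isResidueRoot
  have hs : IsResidueRoot (star w) (-t) := by
    refine ⟨?_, ?_⟩
    · rw [absNorm_star]; simpa [evalAt] using ht.1
    · rw [absNorm_star]; simpa using ht.2
  have hz : evalAt t (star z) = evalAt (-t) z := by simp [evalAt]
  rw [gammaSymbol, gammaSymbol, star_one, mul_one,
    quadSymbol_eq_jacobiSym hd _ t _ w rfl hw.primitive ht,
    quadSymbol_eq_jacobiSym hd _ t _ w rfl hw.primitive ht, kernel_eq_evalAt hw hs,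
    jacobiSym_congr (evalAt_mul_modEq ht.2 _ _), jacobiSym.mul_left, hz]

theorem abs_gammaSymbol_one_le {d : ℤ} (hd : d = -1 ∨ d = 2) {w : Zsqrtd d}
    (hw : IsKernelElt w) : |gammaSymbol w 1| ≤ 1 := by
  obtain ⟨t, ht⟩ := hw.primitive.exists_isResidueRoot
  rw [gammaSymbol, quadSymbol_eq_jacobiSym hd _ t _ w rfl hw.primitive ht]
  exact abs_jacobiSym_le_one _ _

theorem prime_dvd_norm_of_dvd_im_mul {d : ℤ} {w z : Zsqrtd d} (hw : IsKernelElt w)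
    {p : ℕ} (h1 : (p : ℤ) ∣ (w * z).im)
    (h2 : (p : ℤ) ∣ w.norm) : (p : ℤ) ∣ z.norm := by
  -- `b² Norm z ≡ (b x)² - (a y)² ≡ 0 mod p`, where `p` does not divide `b`.
  have hco : IsCoprime (p : ℤ) w.im :=
    (hw.primitive.isCoprime_im.of_isCoprime_of_dvd_right h2).symm
  refine (hco.mul_right hco).dvd_of_dvd_mul_left ?_
  have e : w.im * w.im * z.norm = (w * z).im * (w.im * z.re - w.re * z.im)
      + w.norm * (z.im * z.im) := by
    rw [Zsqrtd.norm_def, Zsqrtd.norm_def, Zsqrtd.im_mul]; ring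
  rw [e]
  exact dvd_add (h1.mul_right _) (h2.mul_right _)

theorem jacobiSym_eq_zero_of_prime_dvd {k : ℤ} {n p : ℕ} (hn : n ≠ 0) (hp : p.Prime)
    (h1 : (p : ℤ) ∣ k) (h2 : p ∣ n) : jacobiSym k n = 0 := by
  refine jacobiSym.eq_zero_iff.2 ⟨hn, fun h => hp.one_lt.ne' ?_⟩
  have := Int.dvd_coe_gcd h1 (Int.natCast_dvd_natCast.2 h2)
  rw [h] at this
  exact Nat.dvd_one.1 (by exact_mod_cast this)

/-- Reciprocity: with `k` the `√d`-coordinate of `w z`, the identity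
`Norm w * Norm z = r ^ 2 - d k ^ 2` shows that `(k / Norm w) (k / Norm z) = 1` unless both symbols
vanish. -/
theorem kernel_comm {d : ℤ} {w z : Zsqrtd d} (hw : IsKernelElt w) (hz : IsKernelElt z) :
    kernel w z = kernel z w := by
  rw [kernel, kernel, mul_comm z w]
  set k := (w * z).im with hk
  have hn := hw.absNorm_pos.ne'
  have hm := hz.absNorm_pos.ne'
  by_cases hco : IsCoprime k ((absNorm w * absNorm z : ℕ) : ℤ)
  · have h8 : (absNorm w * absNorm z) % 8 = 1 := by
      rw [Nat.mul_mod, hw.absNorm_mod, hz.absNorm_mod]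
    have h1 := jacobiSym_eq_one_of_sq_sub h8 hco (a := (w * z).re) (by
      rw [Nat.cast_mul, hw.natCast_absNorm, hz.natCast_absNorm, ← Zsqrtd.norm_mul,
        Zsqrtd.norm_def]
      exact ⟨-d * k, by rw [hk]; ring⟩)
    rw [jacobiSym.mul_right' _ hn hm] at h1
    rcases jacobiSym.trichotomy k (absNorm w) with h | h | h <;> rw [h] at h1 ⊢ <;> omega
  · rw [Int.isCoprime_iff_gcd_eq_one, Int.gcd_eq_natAbs] at hco
    obtain ⟨p, hp, h1, h2⟩ := Nat.Prime.not_coprime_iff_dvd.1 hco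
    have h1' : (p : ℤ) ∣ k := Int.natCast_dvd.2 h1
    rw [Int.natAbs_natCast] at h2
    have key : p ∣ absNorm w ∧ p ∣ absNorm z := by
      simp only [← Int.natCast_dvd_natCast, hw.natCast_absNorm, hz.natCast_absNorm]
      rcases (Nat.Prime.dvd_mul hp).1 h2 with h | h <;>
        rw [← Int.natCast_dvd_natCast] at h
      · rw [hw.natCast_absNorm] at h
        exact ⟨h, prime_dvd_norm_of_dvd_im_mul hw h1' h⟩
      · rw [hz.natCast_absNorm] at h
        exact ⟨prime_dvd_norm_of_dvd_im_mul hz (by rwa [mul_comm]) h, h⟩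
    rw [jacobiSym_eq_zero_of_prime_dvd hn hp h1' key.1,
      jacobiSym_eq_zero_of_prime_dvd hm hp h1' key.2]

/-! ### Incomplete character sums over boxes -/

/-- The elements whose coordinates are at most `L` in absolute value. -/
noncomputable def box (d : ℤ) (L : ℕ) : Finset (Zsqrtd d) :=
  (Finset.Icc (-(L : ℤ)) L ×ˢ Finset.Icc (-(L : ℤ)) L).map
    ⟨fun p => ⟨p.1, p.2⟩, fun p q h => by
      rw [Zsqrtd.mk.injEq] at h; exact Prod.ext h.1 h.2⟩

theorem mem_box {d : ℤ} {L : ℕ} {z : Zsqrtd d} : z ∈ box d L ↔ |z.re| ≤ L ∧ |z.im| ≤ L := by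
  simp only [box, Finset.mem_map, Finset.mem_product, Finset.mem_Icc, abs_le]
  constructor
  · rintro ⟨p, hp, rfl⟩; exact hp
  · intro h; exact ⟨(z.re, z.im), h, rfl⟩

theorem sum_box {d : ℤ} (L : ℕ) (F : Zsqrtd d → ℝ) : ∑ z ∈ box d L, F z =
    ∑ x ∈ Finset.Icc (-(L : ℤ)) L, ∑ y ∈ Finset.Icc (-(L : ℤ)) L, F ⟨x, y⟩ := by
  rw [box, Finset.sum_map, Finset.sum_product]; rfl

theorem card_Icc_neg (L : ℕ) : (Finset.Icc (-(L : ℤ)) L).card = 2 * L + 1 := by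
  rw [Int.card_Icc]; omega

theorem card_box (d : ℤ) (L : ℕ) : (box d L).card = (2 * L + 1) ^ 2 := by
  rw [box, Finset.card_map, Finset.card_product, card_Icc_neg, sq]

theorem sum_Icc_neg_sub (L : ℕ) (g : ℤ → ℝ) :
    ∑ x ∈ Finset.Icc (-(L : ℤ)) L, (g (x + 1) - g x) = g (L + 1) - g (-L) := by
  have h : ∑ x ∈ Finset.Icc (-(L : ℤ)) L, (g (x + 1) - g x) =
      ∑ i ∈ Finset.range (2 * L + 1), (g (((i + 1 : ℕ) : ℤ) - L) - g ((i : ℤ) - L)) := by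
    refine Finset.sum_nbij' (fun x => (x + L).toNat) (fun i => (i : ℤ) - L) ?_ ?_ ?_ ?_ ?_
    · intro x hx; rw [Finset.mem_Icc] at hx; rw [Finset.mem_range]; omega
    · intro i hi; rw [Finset.mem_range] at hi; rw [Finset.mem_Icc]; omega
    · intro x hx; rw [Finset.mem_Icc] at hx; omega
    · intro i hi; omega
    · intro x hx
      rw [Finset.mem_Icc] at hx
      have h1 : (((x + L).toNat : ℕ) : ℤ) = x + L := Int.toNat_of_nonneg (by omega)
      rw [Nat.cast_add, h1]
      congr 2 <;> push_cast <;> ring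
  rw [h, Finset.sum_range_sub (fun i : ℕ => g ((i : ℤ) - L))]
  congr 2 <;> push_cast <;> ring

theorem abs_sum_Icc_shift_sub_le (L : ℕ) {g : ℤ → ℝ} (hg : ∀ x, |g x| ≤ 1) (h : ℤ) :
    |∑ x ∈ Finset.Icc (-(L : ℤ)) L, (g (x + h) - g x)| ≤ 2 * |(h : ℝ)| := by
  have main : ∀ (n : ℕ) (g : ℤ → ℝ), (∀ x, |g x| ≤ 1) →
      |∑ x ∈ Finset.Icc (-(L : ℤ)) L, (g (x + n) - g x)| ≤ 2 * n := by
    intro n g hg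
    induction n with
    | zero => simp
    | succ n ih =>
      have e : ∑ x ∈ Finset.Icc (-(L : ℤ)) L, (g (x + (n + 1 : ℕ)) - g x) =
          (g (L + 1 + n) - g (-L + n)) + ∑ x ∈ Finset.Icc (-(L : ℤ)) L, (g (x + n) - g x) := by
        rw [← sum_Icc_neg_sub L (fun x => g (x + n)), ← Finset.sum_add_distrib]
        refine Finset.sum_congr rfl fun x _ => ?_
        rw [show x + ((n + 1 : ℕ) : ℤ) = x + 1 + n by push_cast; ring]; ring
      rw [e]
      have h1 := hg (L + 1 + n)
      have h2 := hg (-L + n)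
      rw [abs_le] at h1 h2 ih ⊢
      push_cast
      constructor <;> linarith
  obtain ⟨n, rfl | rfl⟩ := h.eq_nat_or_neg
  · simpa using main n g hg
  · have h1 := main n (fun x => g (x + -n)) (fun x => hg _)
    rw [← abs_neg, ← Finset.sum_neg_distrib] at h1
    simpa using h1

theorem abs_sum_box_shift_sub_le {d : ℤ} (L : ℕ) {F : Zsqrtd d → ℝ} (hF : ∀ z, |F z| ≤ 1)
    (r : Zsqrtd d) : |∑ z ∈ box d L, (F (z + r) - F z)| ≤
      2 * (2 * L + 1) * (|(r.re : ℝ)| + |(r.im : ℝ)|) := by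
  have e : ∑ z ∈ box d L, (F (z + r) - F z) =
      (∑ y ∈ Finset.Icc (-(L : ℤ)) L, ∑ x ∈ Finset.Icc (-(L : ℤ)) L,
        (F ⟨x + r.re, y + r.im⟩ - F ⟨x, y + r.im⟩)) +
      ∑ x ∈ Finset.Icc (-(L : ℤ)) L, ∑ y ∈ Finset.Icc (-(L : ℤ)) L,
        (F ⟨x, y + r.im⟩ - F ⟨x, y⟩) := by
    rw [sum_box, Finset.sum_comm (s := Finset.Icc (-(L : ℤ)) L) (t := Finset.Icc (-(L : ℤ)) L)
      (f := fun y x => F ⟨x + r.re, y + r.im⟩ - F ⟨x, y + r.im⟩), ← Finset.sum_add_distrib]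
    refine Finset.sum_congr rfl fun x _ => ?_
    rw [← Finset.sum_add_distrib]
    refine Finset.sum_congr rfl fun y _ => ?_
    rw [sub_add_sub_cancel]; rfl
  have hc : ((Finset.Icc (-(L : ℤ)) L).card : ℝ) = 2 * L + 1 := by
    rw [card_Icc_neg]; push_cast; ring
  have h1 : |∑ y ∈ Finset.Icc (-(L : ℤ)) L, ∑ x ∈ Finset.Icc (-(L : ℤ)) L,
      (F ⟨x + r.re, y + r.im⟩ - F ⟨x, y + r.im⟩)| ≤ (2 * L + 1) * (2 * |(r.re : ℝ)|) := by
    rw [← hc, ← nsmul_eq_mul]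
    refine (Finset.abs_sum_le_sum_abs _ _).trans (Finset.sum_le_card_nsmul _ _ _ fun y _ => ?_)
    exact abs_sum_Icc_shift_sub_le L (g := fun x => F ⟨x, y + r.im⟩) (fun _ => hF _) r.re
  have h2 : |∑ x ∈ Finset.Icc (-(L : ℤ)) L, ∑ y ∈ Finset.Icc (-(L : ℤ)) L,
      (F ⟨x, y + r.im⟩ - F ⟨x, y⟩)| ≤ (2 * L + 1) * (2 * |(r.im : ℝ)|) := by
    rw [← hc, ← nsmul_eq_mul]
    refine (Finset.abs_sum_le_sum_abs _ _).trans (Finset.sum_le_card_nsmul _ _ _ fun x _ => ?_)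
    exact abs_sum_Icc_shift_sub_le L (g := fun y => F ⟨x, y⟩) (fun _ => hF _) r.im
  rw [e]
  refine (abs_add_le _ _).trans ((add_le_add h1 h2).trans_eq ?_)
  ring

/-- A function modulo `c` which changes sign under multiplication by a unit modulo `c` has mean
zero. Its sum over a box is then bounded by comparing the box with its translates by a complete
system of small residues modulo `c`. -/
theorem abs_sum_box_le_of_periodic {d : ℤ} (hd : d = -1 ∨ d = 2) (L : ℕ) {ψ : Zsqrtd d → ℝ}
    (hψ : ∀ z, |ψ z| ≤ 1) {c : Zsqrtd d} (hc : c ≠ 0) (hper : ∀ z u, ψ (z + c * u) = ψ z)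
    {r r' : Zsqrtd d} (hr : c ∣ r * r' - 1) (hneg : ∀ z, ψ (r * z) = -ψ z) :
    |∑ z ∈ box d L, ψ z| ≤ 4 * (2 * L + 1) * (|(c.re : ℝ)| + |(c.im : ℝ)|) := by
  classical
  let Q := Zsqrtd d ⧸ Ideal.span {c}
  have hex : ∀ q : Q, ∃ z : Zsqrtd d, Ideal.Quotient.mk (Ideal.span {c}) z = q ∧
      |z.re| ≤ |c.re| + |c.im| ∧ |z.im| ≤ |c.re| + |c.im| := by
    intro q
    obtain ⟨a, rfl⟩ := Ideal.Quotient.mk_surjective q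
    obtain ⟨u, hu⟩ := exists_small_representative hd a hc
    refine ⟨a - c * u, ?_, hu⟩
    rw [Ideal.Quotient.eq, sub_sub_cancel_left, neg_mem_iff]
    exact Ideal.mem_span_singleton.2 (dvd_mul_right _ _)
  choose rep hrep hre him using hex
  have hmk : ∀ y z : Zsqrtd d, Ideal.Quotient.mk (Ideal.span {c}) y =
      Ideal.Quotient.mk (Ideal.span {c}) z → ψ y = ψ z := by
    intro y z h
    rw [Ideal.Quotient.eq, Ideal.mem_span_singleton] at h
    obtain ⟨u, hu⟩ := h
    rw [← hper z u, ← hu, add_sub_cancel]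
  have hfin : Finite Q := by
    refine Finite.of_injective (β := box d (|c.re| + |c.im|).natAbs)
      (fun q => ⟨rep q, mem_box.2 ?_⟩) ?_
    · rw [Int.natCast_natAbs, abs_of_nonneg (add_nonneg (abs_nonneg c.re) (abs_nonneg c.im))]
      exact ⟨hre q, him q⟩
    · intro p q hpq
      have hpq' : rep p = rep q := congrArg Subtype.val hpq
      rw [← hrep p, ← hrep q, hpq']
  have := Fintype.ofFinite Q
  have hzero : ∑ q : Q, ψ (rep q) = 0 := by
    have hunit : Ideal.Quotient.mk (Ideal.span {c}) r *
        Ideal.Quotient.mk (Ideal.span {c}) r' = 1 := by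
      rw [← map_mul, ← map_one (Ideal.Quotient.mk (Ideal.span {c})), Ideal.Quotient.eq]
      exact Ideal.mem_span_singleton.2 hr
    let u : Qˣ := Units.mkOfMulEqOne _ _ hunit
    have h1 : ∑ q : Q, ψ (rep q) = ∑ q : Q, -ψ (rep q) := by
      rw [← Equiv.sum_comp (Units.mulLeft u)]
      refine Finset.sum_congr rfl fun q _ => ?_
      rw [← hneg]
      refine hmk _ _ ?_
      rw [hrep, map_mul, hrep]; rfl
    rw [Finset.sum_neg_distrib] at h1
    linarith
  have htrans : ∀ z : Zsqrtd d, ∑ q : Q, ψ (z + rep q) = 0 := by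
    intro z
    rw [← hzero, ← Equiv.sum_comp (Equiv.addLeft (Ideal.Quotient.mk (Ideal.span {c}) z))
      (fun q => ψ (rep q))]
    refine Finset.sum_congr rfl fun q _ => hmk _ _ ?_
    rw [hrep, map_add, hrep]; rfl
  have hcard : 0 < (Fintype.card Q : ℝ) := by exact_mod_cast Fintype.card_pos
  refine le_of_mul_le_mul_left ?_ hcard
  have e : (Fintype.card Q : ℝ) * |∑ z ∈ box d L, ψ z| =
      |∑ q : Q, ∑ z ∈ box d L, (ψ (z + rep q) - ψ z)| := by
    have h1 : ∑ q : Q, ∑ z ∈ box d L, (ψ (z + rep q) - ψ z) =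
        -((Fintype.card Q : ℝ) * ∑ z ∈ box d L, ψ z) := by
      simp only [Finset.sum_sub_distrib]
      rw [Finset.sum_comm, Finset.sum_eq_zero (fun z _ => htrans z)]
      simp
    rw [h1, abs_neg, abs_mul, abs_of_pos hcard]
  rw [e, ← nsmul_eq_mul]
  refine (Finset.abs_sum_le_sum_abs _ _).trans (Finset.sum_le_card_nsmul _ _ _ fun q _ => ?_)
  refine (abs_sum_box_shift_sub_le L hψ (rep q)).trans ?_
  have h1 : |((rep q).re : ℝ)| ≤ |(c.re : ℝ)| + |(c.im : ℝ)| := by exact_mod_cast hre q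
  have h2 : |((rep q).im : ℝ)| ≤ |(c.re : ℝ)| + |(c.im : ℝ)| := by exact_mod_cast him q
  have hL : (0 : ℝ) ≤ 2 * L + 1 := by positivity
  nlinarith

/-- For odd non-square `m` the Jacobi symbol modulo `m` takes the value `-1`. -/
theorem exists_jacobiSym_eq_neg_one {m : ℕ} (hm : Odd m) (hsq : ¬ IsSquare m) :
    ∃ r : ℤ, jacobiSym r m = -1 := by
  have hm0 : m ≠ 0 := by rintro rfl; exact absurd hm (by decide)
  have hex : ∃ p, p.Prime ∧ Odd (m.factorization p) := by
    by_contra! h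
    refine hsq ?_
    rw [← Nat.prod_factorization_pow_eq_self hm0]
    refine Finset.isSquare_prod _ fun p hp => ?_
    have := h p (Nat.prime_of_mem_primeFactors hp)
    exact (Nat.not_odd_iff_even.1 this).isSquare_pow p
  obtain ⟨p, hp, hodd⟩ := hex
  have : Fact p.Prime := ⟨hp⟩
  have hpm : p ∣ m := by
    refine (hp.dvd_iff_one_le_factorization hm0).2 hodd.pos
  have hp2 : p ≠ 2 := by
    rintro rfl
    exact (Nat.not_even_iff_odd.2 hm) (even_iff_two_dvd.2 hpm)
  obtain ⟨a, ha⟩ := FiniteField.exists_nonsquare (F := ZMod p) (by rwa [ZMod.ringChar_zmod_n])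
  obtain ⟨k, hk1, hk2⟩ := Nat.chineseRemainder (Nat.coprime_ordCompl hp hm0) a.val 1
  refine ⟨k, ?_⟩
  have h1 : jacobiSym k p = -1 := by
    rw [ZMod.nonsquare_iff_jacobiSym_eq_neg_one]
    have : ((k : ℤ) : ZMod p) = a := by
      rw [Int.cast_natCast, (ZMod.natCast_eq_natCast_iff _ _ _).2 hk1, ZMod.natCast_zmod_val]
    rwa [this]
  have h2 : jacobiSym k (m / p ^ m.factorization p) = 1 := by
    rw [← jacobiSym.one_left (m / p ^ m.factorization p)]
    exact jacobiSym_congr (by exact_mod_cast hk2)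
  conv_lhs => rw [← Nat.ordProj_mul_ordCompl_eq_self m p]
  rw [jacobiSym.mul_right' _ (pow_ne_zero _ hp.ne_zero) (Nat.ordCompl_pos p hm0).ne',
    jacobiSym.pow_right, h1, h2, hodd.neg_one_pow, mul_one]

theorem abs_sum_box_kernel_mul_kernel_le {d : ℤ} (hd : d = -1 ∨ d = 2) (L : ℕ)
    {v w : Zsqrtd d} (hv : IsKernelElt v) (hw : IsKernelElt w)
    (hsq : ¬ IsSquare (absNorm v * absNorm w)) :
    |∑ z ∈ box d L, (kernel v z : ℝ) * kernel w z| ≤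
      4 * (2 * L + 1) * (|((v * w).re : ℝ)| + |((v * w).im : ℝ)|) := by
  have := isDomain_zsqrtd hd
  have hodd : Odd (absNorm v * absNorm w) :=
    hv.primitive.1.odd_absNorm.mul hw.primitive.1.odd_absNorm
  obtain ⟨r, hr⟩ := exists_jacobiSym_eq_neg_one hodd hsq
  have hrw := hr
  rw [jacobiSym.mul_right' _ hv.absNorm_pos.ne' hw.absNorm_pos.ne', ← kernel_intCast hv,
    ← kernel_intCast hw] at hrw
  have hco : IsCoprime r ((absNorm v * absNorm w : ℕ) : ℤ) := by
    rw [Int.isCoprime_iff_gcd_eq_one]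
    by_contra h
    have h0 := jacobiSym.eq_zero_iff.2 ⟨hodd.pos.ne', h⟩
    rw [h0] at hr
    norm_num at hr
  obtain ⟨x, y, hxy⟩ := hco
  rw [Nat.cast_mul, hv.natCast_absNorm, hw.natCast_absNorm] at hxy
  have key := abs_sum_box_le_of_periodic hd L
    (ψ := fun z => (kernel v z : ℝ) * kernel w z) (c := star (v * w))
    (r := (r : Zsqrtd d)) (r' := (x : Zsqrtd d)) ?_ ?_ ?_ ?_ ?_
  · rwa [Zsqrtd.re_star, Zsqrtd.im_star, Int.cast_neg, abs_neg] at key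
  · intro z
    rw [abs_mul]
    have h1 : |(kernel v z : ℝ)| ≤ 1 := by exact_mod_cast abs_kernel_le_one v z
    have h2 : |(kernel w z : ℝ)| ≤ 1 := by exact_mod_cast abs_kernel_le_one w z
    exact mul_le_one₀ h1 (abs_nonneg _) h2
  · rw [Ne, star_eq_zero]
    exact mul_ne_zero hv.primitive.1.ne_zero hw.primitive.1.ne_zero
  · intro z u
    have e1 : star (v * w) * u = star v * (star w * u) := by rw [star_mul']; ring
    have e2 : star (v * w) * u = star w * (star v * u) := by rw [star_mul']; ring
    conv_lhs => rw [e1, kernel_add_mul_star hv, ← e1, e2, kernel_add_mul_star hw]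
  · refine ⟨-(v * w * y), ?_⟩
    have h1 : ((x * r + y * (v.norm * w.norm) : ℤ) : Zsqrtd d) = 1 := by rw [hxy, Int.cast_one]
    push_cast at h1
    rw [Zsqrtd.norm_eq_mul_conj, Zsqrtd.norm_eq_mul_conj] at h1
    rw [star_mul']
    linear_combination h1
  · intro z
    rw [kernel_mul hv, kernel_mul hw]
    have h1 : (kernel v (r : Zsqrtd d) : ℝ) * kernel w (r : Zsqrtd d) = -1 := by
      exact_mod_cast hrw
    push_cast
    linear_combination (kernel v z : ℝ) * kernel w z * h1

/-! ### Hölder's inequality and the large sieve -/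

open Classical in
/-- The mean square of `∑ θ_w κ(w, ζ)` over the box: pairs `(v, w)` for which the product of the
norms is a square are bounded trivially, the others by the incomplete character sum. -/
theorem sum_box_normSq_le {d : ℤ} (hd : d = -1 ∨ d = 2) (L : ℕ) {G : ℝ}
    (W : Finset (Zsqrtd d)) (hW : ∀ w ∈ W, IsKernelElt w)
    (hG : ∀ v ∈ W, ∀ w ∈ W, |((v * w).re : ℝ)| + |((v * w).im : ℝ)| ≤ G)
    (θ : Zsqrtd d → ℂ) (hθ : ∀ w, ‖θ w‖ ≤ 1) :
    ∑ z ∈ box d L, ‖∑ w ∈ W, θ w * (kernel w z : ℂ)‖ ^ 2 ≤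
      ((W ×ˢ W).filter fun p => IsSquare (absNorm p.1 * absNorm p.2)).card * (2 * L + 1) ^ 2 +
        (W.card : ℝ) ^ 2 * (4 * (2 * L + 1) * G) := by
  have h1 : ((∑ z ∈ box d L, ‖∑ w ∈ W, θ w * (kernel w z : ℂ)‖ ^ 2 : ℝ) : ℂ) =
      ∑ p ∈ W ×ˢ W, θ p.1 * star (θ p.2) *
        ((∑ z ∈ box d L, (kernel p.1 z : ℝ) * kernel p.2 z : ℝ) : ℂ) := by
    push_cast
    simp only [Finset.mul_sum]
    rw [Finset.sum_comm]
    refine Finset.sum_congr rfl fun z _ => ?_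
    rw [← Complex.mul_conj', map_sum, Finset.sum_mul_sum, ← Finset.sum_product']
    refine Finset.sum_congr rfl fun p _ => ?_
    rw [map_mul, map_intCast, Complex.star_def]
    ring
  have h0 : 0 ≤ ∑ z ∈ box d L, ‖∑ w ∈ W, θ w * (kernel w z : ℂ)‖ ^ 2 :=
    Finset.sum_nonneg fun _ _ => sq_nonneg _
  have h2 : ∑ z ∈ box d L, ‖∑ w ∈ W, θ w * (kernel w z : ℂ)‖ ^ 2 ≤
      ∑ p ∈ W ×ˢ W, |∑ z ∈ box d L, (kernel p.1 z : ℝ) * kernel p.2 z| := by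
    rw [← abs_of_nonneg h0, ← Real.norm_eq_abs, ← Complex.norm_real, h1]
    refine (norm_sum_le _ _).trans (Finset.sum_le_sum fun p _ => ?_)
    rw [norm_mul, norm_mul, norm_star, Complex.norm_real, Real.norm_eq_abs]
    exact mul_le_of_le_one_left (abs_nonneg _)
      (mul_le_one₀ (hθ _) (norm_nonneg _) (hθ _))
  refine h2.trans ?_
  rw [← Finset.sum_filter_add_sum_filter_not (W ×ˢ W)
    (fun p => IsSquare (absNorm p.1 * absNorm p.2))]
  have hL : (0 : ℝ) ≤ 2 * L + 1 := by positivity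
  refine add_le_add ?_ ?_
  · rw [← nsmul_eq_mul]
    refine Finset.sum_le_card_nsmul _ _ _ fun p _ => ?_
    have hc : ((box d L).card : ℝ) = (2 * L + 1) ^ 2 := by rw [card_box]; push_cast; ring
    rw [← hc]
    refine (Finset.abs_sum_le_sum_abs _ _).trans ?_
    refine (Finset.sum_le_card_nsmul _ _ 1 fun z _ => ?_).trans_eq (by simp)
    rw [abs_mul]
    have h1 : |(kernel p.1 z : ℝ)| ≤ 1 := by exact_mod_cast abs_kernel_le_one p.1 z
    have h2 : |(kernel p.2 z : ℝ)| ≤ 1 := by exact_mod_cast abs_kernel_le_one p.2 z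
    exact mul_le_one₀ h1 (abs_nonneg _) h2
  · rcases W.eq_empty_or_nonempty with rfl | ⟨w₀, hw₀⟩
    · simp
    have hG0 : 0 ≤ G := le_trans (by positivity) (hG w₀ hw₀ w₀ hw₀)
    have hcard : (((W ×ˢ W).filter fun p => ¬ IsSquare (absNorm p.1 * absNorm p.2)).card : ℝ) ≤
        (W.card : ℝ) ^ 2 := by
      have := Finset.card_filter_le (W ×ˢ W) (fun p => ¬ IsSquare (absNorm p.1 * absNorm p.2))
      rw [Finset.card_product, ← sq] at this
      exact_mod_cast this
    refine le_trans ?_ (mul_le_mul_of_nonneg_right hcard (by positivity))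
    rw [← nsmul_eq_mul]
    refine Finset.sum_le_card_nsmul _ _ _ fun p hp => ?_
    rw [Finset.mem_filter, Finset.mem_product] at hp
    refine (abs_sum_box_kernel_mul_kernel_le hd L (hW _ hp.1.1) (hW _ hp.1.2) hp.2).trans ?_
    exact mul_le_mul_of_nonneg_left (hG _ hp.1.1 _ hp.1.2) (by positivity)

open Classical in
/-- Raising the inner sum to the power `k` replaces `z` by a product of `k` elements, which runs
over a long range; multiplicativity of the kernel and the Cauchy–Schwarz inequality then reduce
the bilinear form to a mean square over the box. -/
theorem norm_kernel_sum_pow_le {d : ℤ} (hd : d = -1 ∨ d = 2) (k L B : ℕ) (hk : k ≠ 0) {G : ℝ}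
    (W Z : Finset (Zsqrtd d)) (hW : ∀ w ∈ W, IsKernelElt w)
    (hG : ∀ v ∈ W, ∀ w ∈ W, |((v * w).re : ℝ)| + |((v * w).im : ℝ)| ≤ G)
    (hbox : ∀ g ∈ Fintype.piFinset (fun _ : Fin k => Z), ∏ i, g i ∈ box d L)
    (hB : ∀ ζ : Zsqrtd d,
      ((Fintype.piFinset (fun _ : Fin k => Z)).filter fun g => ∏ i, g i = ζ).card ≤ B)
    (α β : Zsqrtd d → ℂ) (hα : ∀ w ∈ W, ‖α w‖ ≤ 1) (hβ : ∀ z ∈ Z, ‖β z‖ ≤ 1) :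
    ‖∑ w ∈ W, ∑ z ∈ Z, α w * β z * (kernel w z : ℂ)‖ ^ (2 * k) ≤
      (W.card : ℝ) ^ (2 * k - 2) * (Z.card : ℝ) ^ k * B *
      (((W ×ˢ W).filter fun p => IsSquare (absNorm p.1 * absNorm p.2)).card * (2 * L + 1) ^ 2 +
        (W.card : ℝ) ^ 2 * (4 * (2 * L + 1) * G)) := by
  set s : Zsqrtd d → ℂ := fun w => ∑ z ∈ Z, β z * (kernel w z : ℂ) with hs
  set X : ℝ := ∑ w ∈ W, ‖s w‖ ^ k with hX
  have hX0 : 0 ≤ X := Finset.sum_nonneg fun _ _ => by positivity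
  have h1 : ‖∑ w ∈ W, ∑ z ∈ Z, α w * β z * (kernel w z : ℂ)‖ ≤ ∑ w ∈ W, ‖s w‖ := by
    refine (norm_sum_le _ _).trans (Finset.sum_le_sum fun w hw => ?_)
    have e : ∑ z ∈ Z, α w * β z * (kernel w z : ℂ) = α w * s w := by
      rw [hs, Finset.mul_sum]
      exact Finset.sum_congr rfl fun z _ => mul_assoc _ _ _
    rw [e, norm_mul]
    exact mul_le_of_le_one_left (norm_nonneg _) (hα w hw)
  have h2 : (∑ w ∈ W, ‖s w‖) ^ k ≤ (W.card : ℝ) ^ (k - 1) * X := by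
    rcases W.eq_empty_or_nonempty with rfl | hne
    · simp [hX, hk]
    obtain ⟨m, rfl⟩ := Nat.exists_eq_succ_of_ne_zero hk
    have := pow_sum_div_card_le_sum_pow (s := W) (f := fun w => ‖s w‖)
      (fun _ _ => norm_nonneg _) m
    rw [div_le_iff₀ (by have := hne.card_pos; positivity)] at this
    rw [mul_comm]
    exact this
  choose! θ hθ1 hθ2 using fun w : Zsqrtd d => RCLike.exists_norm_eq_mul_self (s w ^ k)
  set T : Zsqrtd d → ℂ := fun ζ => ∑ w ∈ W, θ w * (kernel w ζ : ℂ) with hT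
  have hXT : X ≤ ∑ g ∈ Fintype.piFinset (fun _ : Fin k => Z), ‖T (∏ i, g i)‖ := by
    have e : (X : ℂ) = ∑ g ∈ Fintype.piFinset (fun _ : Fin k => Z),
        (∏ i, β (g i)) * T (∏ i, g i) := by
      rw [hX, Complex.ofReal_sum]
      simp only [hT, Finset.mul_sum]
      rw [Finset.sum_comm]
      refine Finset.sum_congr rfl fun w hw => ?_
      rw [← norm_pow]
      refine (hθ2 w).trans ?_
      have e1 : s w ^ k = ∏ _i : Fin k, ∑ z ∈ Z, β z * (kernel w z : ℂ) := by
        rw [Finset.prod_const, Finset.card_univ, Fintype.card_fin]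
      rw [e1, Finset.prod_univ_sum, Finset.mul_sum]
      refine Finset.sum_congr rfl fun g _ => ?_
      rw [Finset.prod_mul_distrib, kernel_prod (hW w hw), Int.cast_prod]
      ring
    rw [← abs_of_nonneg hX0, ← Real.norm_eq_abs, ← Complex.norm_real, e]
    refine (norm_sum_le _ _).trans (Finset.sum_le_sum fun g hg => ?_)
    rw [norm_mul, norm_prod]
    refine mul_le_of_le_one_left (norm_nonneg _) (Finset.prod_le_one (fun _ _ => norm_nonneg _) ?_)
    exact fun i _ => hβ _ (Fintype.mem_piFinset.1 hg i)
  have hT2 : ∑ g ∈ Fintype.piFinset (fun _ : Fin k => Z), ‖T (∏ i, g i)‖ ^ 2 ≤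
      B * ∑ ζ ∈ box d L, ‖T ζ‖ ^ 2 := by
    rw [← Finset.sum_fiberwise_of_maps_to hbox, Finset.mul_sum]
    refine Finset.sum_le_sum fun ζ _ => ?_
    rw [Finset.sum_congr rfl (g := fun _ => ‖T ζ‖ ^ 2)
      (fun g hg => by rw [(Finset.mem_filter.1 hg).2]), Finset.sum_const, nsmul_eq_mul]
    exact mul_le_mul_of_nonneg_right (by exact_mod_cast hB ζ) (sq_nonneg _)
  have hX2 : X ^ 2 ≤ (Z.card : ℝ) ^ k * (B * ∑ ζ ∈ box d L, ‖T ζ‖ ^ 2) := by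
    have hc : ((Fintype.piFinset (fun _ : Fin k => Z)).card : ℝ) = (Z.card : ℝ) ^ k := by
      rw [Fintype.card_piFinset]; simp
    rw [← hc]
    refine (pow_le_pow_left₀ hX0 hXT 2).trans (sq_sum_le_card_mul_sum_sq.trans ?_)
    exact mul_le_mul_of_nonneg_left hT2 (by positivity)
  have hmean := sum_box_normSq_le hd L W hW hG θ (fun w => (hθ1 w).le)
  calc ‖∑ w ∈ W, ∑ z ∈ Z, α w * β z * (kernel w z : ℂ)‖ ^ (2 * k)
      ≤ (∑ w ∈ W, ‖s w‖) ^ (2 * k) := pow_le_pow_left₀ (norm_nonneg _) h1 _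
    _ = ((∑ w ∈ W, ‖s w‖) ^ k) ^ 2 := by rw [← pow_mul, mul_comm]
    _ ≤ ((W.card : ℝ) ^ (k - 1) * X) ^ 2 := by gcongr
    _ = (W.card : ℝ) ^ (2 * k - 2) * X ^ 2 := by
        rw [mul_pow, ← pow_mul, show (k - 1) * 2 = 2 * k - 2 by omega]
    _ ≤ (W.card : ℝ) ^ (2 * k - 2) *
        ((Z.card : ℝ) ^ k * (B * ∑ ζ ∈ box d L, ‖T ζ‖ ^ 2)) := by gcongr
    _ = (W.card : ℝ) ^ (2 * k - 2) * (Z.card : ℝ) ^ k * B * ∑ ζ ∈ box d L, ‖T ζ‖ ^ 2 := by ring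
    _ ≤ _ := mul_le_mul_of_nonneg_left hmean (by positivity)

/-! ### The divisor bound -/

theorem natCast_pow_rpow_eq {p : ℕ} (e : ℕ) (ε : ℝ) :
    ((p ^ e : ℕ) : ℝ) ^ ε = ((p : ℝ) ^ ε) ^ e := by
  rw [Nat.cast_pow, ← Real.rpow_natCast, ← Real.rpow_natCast, ← Real.rpow_mul (by positivity),
    ← Real.rpow_mul (by positivity), mul_comm]

/-- The divisor function is `O(n ^ ε)`: the factor `(e + 1) / p ^ (e ε)` of a prime power `p ^ e`
is at most `1` unless `p < 2 ^ (1 / ε)`, and is bounded in any case. -/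
theorem exists_card_divisors_le {ε : ℝ} (hε : 0 < ε) :
    ∃ C : ℝ, 1 ≤ C ∧ ∀ n : ℕ, n ≠ 0 → (n.divisors.card : ℝ) ≤ C * (n : ℝ) ^ ε := by
  obtain ⟨T, hT⟩ := exists_nat_ge ((2 : ℝ) ^ (1 / ε))
  have hlog : 0 < Real.log 2 := Real.log_pos (by norm_num)
  set c : ℝ := 1 + 1 / (ε * Real.log 2) with hc
  have hc1 : 1 ≤ c := by rw [hc]; have : 0 < 1 / (ε * Real.log 2) := by positivity
                         linarith
  refine ⟨c ^ T, one_le_pow₀ hc1, fun n hn => ?_⟩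
  have hloc : ∀ p ∈ n.primeFactors, ((n.factorization p + 1 : ℕ) : ℝ) ≤
      (if p < T then c else 1) * ((p ^ n.factorization p : ℕ) : ℝ) ^ ε := by
    intro p hp
    have hpp := Nat.prime_of_mem_primeFactors hp
    set e := n.factorization p
    rw [natCast_pow_rpow_eq]
    split_ifs with hpT
    · have h1 : (2 : ℝ) ^ ε ≤ (p : ℝ) ^ ε :=
        Real.rpow_le_rpow (by norm_num) (by exact_mod_cast hpp.two_le) hε.le
      have h2 : 1 + ε * Real.log 2 ≤ (2 : ℝ) ^ ε := by
        rw [Real.rpow_def_of_pos (by norm_num)]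
        have := Real.add_one_le_exp (Real.log 2 * ε)
        linarith
      have h3 : 1 + e * (ε * Real.log 2) ≤ ((p : ℝ) ^ ε) ^ e := by
        refine (one_add_mul_le_pow (a := ε * Real.log 2) (by
          have : 0 < ε * Real.log 2 := by positivity
          linarith) e).trans ?_
        exact pow_le_pow_left₀ (by positivity) (h2.trans h1) e
      calc ((e + 1 : ℕ) : ℝ) ≤ c * (1 + e * (ε * Real.log 2)) := by
            have h4 : c * (1 + e * (ε * Real.log 2)) =
                1 + e + e * (ε * Real.log 2) + 1 / (ε * Real.log 2) := by
              rw [hc]; field_simp; ring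
            rw [h4]; push_cast
            have : 0 ≤ e * (ε * Real.log 2) + 1 / (ε * Real.log 2) := by positivity
            linarith
        _ ≤ _ := mul_le_mul_of_nonneg_left h3 (by linarith)
    · rw [one_mul]
      have h1 : (2 : ℝ) ≤ (p : ℝ) ^ ε := by
        have h2 : (2 : ℝ) ^ (1 / ε) ≤ p := hT.trans (by exact_mod_cast not_lt.1 hpT)
        calc (2 : ℝ) = ((2 : ℝ) ^ (1 / ε)) ^ ε := by
              rw [← Real.rpow_mul (by norm_num), one_div_mul_cancel hε.ne', Real.rpow_one]
          _ ≤ _ := Real.rpow_le_rpow (by positivity) h2 hε.le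
      refine le_trans ?_ (pow_le_pow_left₀ (by norm_num) h1 e)
      exact_mod_cast Nat.lt_two_pow_self
  have hprod : (n : ℝ) ^ ε = ∏ p ∈ n.primeFactors, ((p ^ n.factorization p : ℕ) : ℝ) ^ ε := by
    rw [Real.finsetProd_rpow _ _ (fun _ _ => by positivity), ← Nat.cast_prod]
    congr 2
    exact (Nat.prod_factorization_pow_eq_self hn).symm
  rw [Nat.card_divisors hn, Nat.cast_prod, hprod]
  refine (Finset.prod_le_prod (fun _ _ => by positivity) hloc).trans ?_
  rw [Finset.prod_mul_distrib]
  refine mul_le_mul_of_nonneg_right ?_ (Finset.prod_nonneg fun _ _ => by positivity)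
  rw [Finset.prod_ite, Finset.prod_const, Finset.prod_const_one, mul_one]
  refine pow_le_pow_right₀ hc1 ?_
  calc (n.primeFactors.filter (· < T)).card ≤ (Finset.range T).card :=
        Finset.card_le_card fun p hp => Finset.mem_range.2 (Finset.mem_filter.1 hp).2
    _ = T := Finset.card_range T

theorem two_pow_card_primeFactors_le {n : ℕ} (hn : n ≠ 0) :
    2 ^ n.primeFactors.card ≤ n.divisors.card := by
  rw [Nat.card_divisors hn, ← Finset.prod_const]
  refine Finset.prod_le_prod' fun p hp => ?_
  have := (Nat.prime_of_mem_primeFactors hp).factorization_pos_of_dvd hn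
    (Nat.dvd_of_mem_primeFactors hp)
  omega

/-! ### Elements of given norm -/

/-- The coordinates of `w` are bounded by a multiple of the square root of its norm. -/
structure IsBalanced {d : ℤ} (w : Zsqrtd d) : Prop where
  re_sq_le : w.re ^ 2 ≤ 2 * w.norm
  im_sq_le : w.im ^ 2 ≤ 2 * w.norm

theorem IsNormalized.isBalanced {d : ℤ} {w : Zsqrtd d} (h : IsNormalized w) : IsBalanced w := by
  rcases h with ⟨rfl, -⟩ | ⟨rfl, h⟩
  · constructor <;> rw [Zsqrtd.norm_def] <;> nlinarith [sq_nonneg w.re, sq_nonneg w.im]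
  · have h4 : 4 * w.im ^ 2 ≤ w.re ^ 2 := by
      simp only [InCone, Zsqrtd.re_neg, Zsqrtd.im_neg] at h
      rcases h with ⟨h1, h2, h3⟩ | ⟨h1, h2, h3⟩ <;> nlinarith
    constructor <;> rw [Zsqrtd.norm_def] <;> nlinarith [sq_nonneg w.re, sq_nonneg w.im]

theorem abs_mul_le_of_sq_le {x y m : ℤ} (hx : x ^ 2 ≤ m) (hy : y ^ 2 ≤ m) : |x * y| ≤ m := by
  rw [abs_le]
  constructor <;> nlinarith [sq_nonneg (x - y), sq_nonneg (x + y)]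

theorem IsBalanced.abs_mul_le {d : ℤ} {v w : Zsqrtd d} (hv : IsBalanced v) (hw : IsBalanced w)
    {n : ℤ} (hvn : v.norm ≤ n) (hwn : w.norm ≤ n) :
    |v.re * w.re| ≤ 2 * n ∧ |v.im * w.im| ≤ 2 * n ∧ |v.re * w.im| ≤ 2 * n ∧
      |v.im * w.re| ≤ 2 * n := by
  have h1 : v.re ^ 2 ≤ 2 * n := hv.re_sq_le.trans (by linarith)
  have h2 : v.im ^ 2 ≤ 2 * n := hv.im_sq_le.trans (by linarith)
  have h3 : w.re ^ 2 ≤ 2 * n := hw.re_sq_le.trans (by linarith)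
  have h4 : w.im ^ 2 ≤ 2 * n := hw.im_sq_le.trans (by linarith)
  exact ⟨abs_mul_le_of_sq_le h1 h3, abs_mul_le_of_sq_le h2 h4, abs_mul_le_of_sq_le h1 h4,
    abs_mul_le_of_sq_le h2 h3⟩

/-- Two square roots of `d` modulo the odd number `n` agree if they are congruent to a third one
modulo the same primes. -/
theorem dvd_sub_of_same_primes {d : ℤ} (hd : d = -1 ∨ d = 2) {n : ℕ} (hn : Odd n) {t₀ t t' : ℤ}
    (h₀ : (n : ℤ) ∣ t₀ ^ 2 - d) (h : (n : ℤ) ∣ t ^ 2 - d) (h' : (n : ℤ) ∣ t' ^ 2 - d)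
    (hS : ∀ p ∈ n.primeFactors, (p : ℤ) ∣ t - t₀ ↔ (p : ℤ) ∣ t' - t₀) : (n : ℤ) ∣ t - t' := by
  have hn0 : n ≠ 0 := hn.pos.ne'
  rw [Int.natCast_dvd, Nat.dvd_iff_prime_pow_dvd_dvd]
  intro p k hp hpk
  rw [← Int.natCast_dvd]
  rcases Nat.eq_zero_or_pos k with rfl | hk
  · simp
  have hpn : p ∣ n := (dvd_pow_self p hk.ne').trans hpk
  have hpZ : Prime (p : ℤ) := Nat.prime_iff_prime_int.1 hp
  have hp2 : ¬ (p : ℤ) ∣ 2 := by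
    intro h2
    have h3 : p ∣ 2 := by exact_mod_cast h2
    rw [(Nat.prime_dvd_prime_iff_eq hp Nat.prime_two).1 h3] at hpn
    exact (Nat.not_even_iff_odd.2 hn) (even_iff_two_dvd.2 hpn)
  have hpd : ¬ (p : ℤ) ∣ d := by
    rcases hd with rfl | rfl
    · intro h1
      exact hpZ.not_isUnit (isUnit_of_dvd_unit h1 (by decide))
    · exact hp2
  have hpt : ¬ (p : ℤ) ∣ t₀ := by
    intro h1
    refine hpd ?_
    have h2 := dvd_sub (h1.mul_left t₀) ((Int.natCast_dvd_natCast.2 hpn).trans h₀)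
    rwa [← sq, sub_sub_cancel] at h2
  have hpkn : ((p ^ k : ℕ) : ℤ) ∣ n := Int.natCast_dvd_natCast.2 hpk
  -- Modulo `p ^ k` every root is `t₀` or `-t₀`.
  have key : ∀ s : ℤ, (n : ℤ) ∣ s ^ 2 - d →
      ((p : ℤ) ∣ s - t₀ → ((p ^ k : ℕ) : ℤ) ∣ s - t₀) ∧
      (¬ (p : ℤ) ∣ s - t₀ → ((p ^ k : ℕ) : ℤ) ∣ s + t₀) := by
    intro s hs
    have hdiv : ((p ^ k : ℕ) : ℤ) ∣ (s - t₀) * (s + t₀) := by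
      have := hpkn.trans (dvd_sub hs h₀)
      have e : (s - t₀) * (s + t₀) = s ^ 2 - d - (t₀ ^ 2 - d) := by ring
      rwa [e]
    rw [Nat.cast_pow] at hdiv ⊢
    constructor
    · intro h1
      refine hpZ.pow_dvd_of_dvd_mul_right k (fun h2 => ?_) hdiv
      have h3 := dvd_sub h2 h1
      have e : s + t₀ - (s - t₀) = 2 * t₀ := by ring
      rw [e] at h3
      exact (hpZ.dvd_or_dvd h3).elim hp2 hpt
    · intro h1
      exact hpZ.pow_dvd_of_dvd_mul_left k h1 hdiv
  have hmem : p ∈ n.primeFactors := Nat.mem_primeFactors.2 ⟨hp, hpn, hn0⟩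
  by_cases hc : (p : ℤ) ∣ t - t₀
  · have := dvd_sub ((key t h).1 hc) ((key t' h').1 ((hS p hmem).1 hc))
    rwa [sub_sub_sub_cancel_right] at this
  · have := dvd_sub ((key t h).2 hc) ((key t' h').2 (fun h1 => hc ((hS p hmem).2 h1)))
    rwa [add_sub_add_right_eq_sub] at this

/-- If `v` and `w` have the same norm `n` and the same residue root, then `v / w = v w̄ / n` is
integral, hence a unit. -/
theorem exists_mul_star_eq_of_residueRoot_congr {d : ℤ} {v w : Zsqrtd d} {t t' : ℤ}
    (ht : IsResidueRoot v t) (ht' : IsResidueRoot w t') {n : ℕ} (hv : absNorm v = n)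
    (hw : absNorm w = n) (h : (n : ℤ) ∣ t - t') :
    ∃ κ : Zsqrtd d, v * star w = ((n : ℤ) : Zsqrtd d) * κ := by
  obtain ⟨h1, h2⟩ := ht
  obtain ⟨h3, -⟩ := ht'
  rw [hv] at h1 h2
  rw [hw] at h3
  have h4 : (n : ℤ) ∣ evalAt t w := by
    have e : evalAt t w = evalAt t' w + (t - t') * w.im := by simp only [evalAt]; ring
    rw [e]
    exact dvd_add h3 (h.mul_right _)
  refine (Zsqrtd.intCast_dvd _ _).2 ⟨?_, ?_⟩
  · have e : (v * star w).re = evalAt t v * w.re - evalAt t w * (t * v.im)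
        + (t ^ 2 - d) * (v.im * w.im) := by
      simp only [evalAt, Zsqrtd.re_mul, Zsqrtd.re_star, Zsqrtd.im_star]; ring
    rw [e]
    exact dvd_add (dvd_sub (h1.mul_right _) (h4.mul_right _)) (h2.mul_right _)
  · have e : (v * star w).im = evalAt t w * v.im - evalAt t v * w.im := by
      simp only [evalAt, Zsqrtd.im_mul, Zsqrtd.re_star, Zsqrtd.im_star]; ring
    rw [e]
    exact dvd_sub (h4.mul_right _) (h1.mul_right _)

/-- There are at most `169 * 2 ^ ω(n)` balanced primitive elements of norm `n`: an element
determines a square root of `d` modulo `n`, and conversely is determined by it up to one of the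
at most `169` units with coordinates bounded by `6`. -/
theorem card_le_of_absNorm_eq {d : ℤ} (hd : d = -1 ∨ d = 2) {n : ℕ} (E : Finset (Zsqrtd d))
    (hE : ∀ w ∈ E, IsKernelElt w ∧ IsBalanced w ∧ absNorm w = n) :
    E.card ≤ 169 * 2 ^ n.primeFactors.card := by
  classical
  rcases E.eq_empty_or_nonempty with rfl | ⟨w₀, hw₀⟩
  · simp
  choose! t ht using fun (w : Zsqrtd d) (hw : IsPrimitiveElt w) => hw.exists_isResidueRoot
  have hn : Odd n := by
    obtain ⟨h1, -, h3⟩ := hE w₀ hw₀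
    rw [← h3]; exact h1.primitive.1.odd_absNorm
  have hnorm : ∀ w ∈ E, w.norm = n := fun w hw => by
    rw [← (hE w hw).1.natCast_absNorm, (hE w hw).2.2]
  let S : Zsqrtd d → Finset ℕ := fun w => n.primeFactors.filter fun p => (p : ℤ) ∣ t w - t w₀
  have hroot : ∀ w ∈ E, (n : ℤ) ∣ t w ^ 2 - d := fun w hw => by
    have := (ht w (hE w hw).1.primitive).2
    rwa [(hE w hw).2.2] at this
  have hfib : ∀ a ∈ E.image S, (E.filter fun w => S w = a).card ≤ 169 := by
    intro a ha
    obtain ⟨v, hv, rfl⟩ := Finset.mem_image.1 ha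
    have hex : ∀ w ∈ E.filter (fun w => S w = S v),
        ∃ κ : Zsqrtd d, w * star v = ((n : ℤ) : Zsqrtd d) * κ := by
      intro w hw
      obtain ⟨hwE, hwS⟩ := Finset.mem_filter.1 hw
      refine exists_mul_star_eq_of_residueRoot_congr (ht w (hE w hwE).1.primitive)
        (ht v (hE v hv).1.primitive) (hE w hwE).2.2 (hE v hv).2.2
        (dvd_sub_of_same_primes hd hn (hroot w₀ hw₀) (hroot w hwE) (hroot v hv) fun p hp => ?_)
      have := Finset.ext_iff.1 hwS p
      simp only [S, Finset.mem_filter, hp, true_and] at this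
      exact this
    choose! κ hκ using hex
    have hcard : (box d 6).card = 169 := by rw [card_box]; norm_num
    rw [← hcard]
    refine Finset.card_le_card_of_injOn κ (fun w hw => ?_) (fun w hw w' hw' hww => ?_)
    · have hwE := (Finset.mem_filter.1 hw).1
      obtain ⟨b1, b2, b3, b4⟩ := (hE w hwE).2.1.abs_mul_le (hE v hv).2.1 (hnorm w hwE).le
        (hnorm v hv).le
      have hre := congrArg Zsqrtd.re (hκ w hw)
      have him := congrArg Zsqrtd.im (hκ w hw)
      rw [Zsqrtd.re_smul] at hre
      rw [Zsqrtd.im_smul] at him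
      simp only [Zsqrtd.re_mul, Zsqrtd.im_mul, Zsqrtd.re_star, Zsqrtd.im_star] at hre him
      have hnpos : (0 : ℤ) < n := by exact_mod_cast hn.pos
      rw [abs_le] at b1 b2 b3 b4
      refine Finset.mem_coe.2 (mem_box.2 ⟨?_, ?_⟩)
      · refine le_of_mul_le_mul_left ?_ hnpos
        rw [← abs_of_pos hnpos, ← abs_mul, ← hre, abs_of_pos hnpos, abs_le]
        rcases hd with rfl | rfl <;> push_cast <;> constructor <;> nlinarith
      · refine le_of_mul_le_mul_left ?_ hnpos
        rw [← abs_of_pos hnpos, ← abs_mul, ← him, abs_of_pos hnpos, abs_le]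
        push_cast
        constructor <;> nlinarith
    · have e : w * star v = w' * star v := by rw [hκ w hw, hκ w' hw', hww]
      have := isDomain_zsqrtd hd
      refine mul_right_cancel₀ ?_ e
      rw [Ne, star_eq_zero]
      exact (hE v hv).1.primitive.1.ne_zero
  refine (Finset.card_le_mul_card_image E 169 hfib).trans (Nat.mul_le_mul_left _ ?_)
  rw [← Finset.card_powerset]
  refine Finset.card_le_card fun a ha => ?_
  obtain ⟨w, -, rfl⟩ := Finset.mem_image.1 ha
  exact Finset.mem_powerset.2 (Finset.filter_subset _ _)

/-- Distinct primes dividing the norm of a primitive element lie below distinct prime ideals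
dividing it. -/
theorem card_primeFactors_absNorm_le {d : ℤ} (hd : d = -1 ∨ d = 2) {w : Zsqrtd d}
    (hw : IsPrimitiveElt w) {f : ℕ} (hf : AtMostPrimeFactors f w) :
    (absNorm w).primeFactors.card ≤ f := by
  classical
  have := isDomain_zsqrtd hd
  have := isDedekindDomain_zsqrtd hd
  obtain ⟨t, ht⟩ := hw.exists_isResidueRoot
  have hex : ∀ p : (absNorm w).primeFactors, ∃ v : HeightOneSpectrum (Zsqrtd d),
      v.asIdeal ∣ Ideal.span {w} ∧ ∀ q : ℕ, (q : Zsqrtd d) ∈ v.asIdeal ↔ (p : ℕ) ∣ q := by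
    rintro ⟨p, hp⟩
    have hpp := Nat.prime_of_mem_primeFactors hp
    have hpn : (p : ℤ) ∣ absNorm w := Int.natCast_dvd_natCast.2 (Nat.dvd_of_mem_primeFactors hp)
    have : Fact p.Prime := ⟨hpp⟩
    have hroot : ((t : ℤ) : ZMod p) * ((t : ℤ) : ZMod p) = ((d : ℤ) : ZMod p) := by
      rw [← Int.cast_mul, ← sub_eq_zero, ← Int.cast_sub, ZMod.intCast_zmod_eq_zero_iff_dvd, ← sq]
      exact hpn.trans ht.2
    let φ : Zsqrtd d →+* ZMod p := Zsqrtd.lift ⟨(t : ZMod p), hroot⟩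
    have hφ : ∀ z, φ z = ((evalAt t z : ℤ) : ZMod p) := by
      intro z
      simp [φ, Zsqrtd.lift, evalAt, mul_comm]
    have hφn : ∀ q : ℕ, (q : Zsqrtd d) ∈ RingHom.ker φ ↔ p ∣ q := by
      intro q
      rw [RingHom.mem_ker, map_natCast, ZMod.natCast_eq_zero_iff]
    refine ⟨⟨RingHom.ker φ, RingHom.ker_isPrime φ, fun hbot => ?_⟩, ?_, hφn⟩
    · have h1 : (p : Zsqrtd d) ∈ RingHom.ker φ := (hφn p).2 dvd_rfl
      rw [hbot, Ideal.mem_bot] at h1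
      exact hpp.ne_zero (by exact_mod_cast h1)
    · rw [Ideal.dvd_span_singleton, RingHom.mem_ker, hφ, ZMod.intCast_zmod_eq_zero_iff_dvd]
      exact hpn.trans ht.1
  choose v hv1 hv2 using hex
  have hinj : Function.Injective v := by
    intro p q hpq
    refine Subtype.ext ((Nat.prime_dvd_prime_iff_eq (Nat.prime_of_mem_primeFactors p.2)
      (Nat.prime_of_mem_primeFactors q.2)).1 ?_)
    rw [← hv2 p, hpq, hv2 q]
  have hsub : ((Finset.univ.image v : Finset (HeightOneSpectrum (Zsqrtd d))) :
      Set (HeightOneSpectrum (Zsqrtd d))) ⊆ {v | v.asIdeal ∣ Ideal.span {w}} := by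
    intro x hx
    obtain ⟨p, -, rfl⟩ := Finset.mem_image.1 (Finset.mem_coe.1 hx)
    exact hv1 p
  have hle := (Set.encard_le_encard hsub).trans hf
  rw [Set.encard_coe_eq_coe_finsetCard, Finset.card_image_of_injective _ hinj, Finset.card_univ,
    Fintype.card_coe] at hle
  exact_mod_cast hle

/-! ### Counting lattice points and coincidences -/

theorem card_le_of_sub_le (S : Finset ℤ) {l : ℝ} (hl : 0 ≤ l)
    (h : ∀ a ∈ S, ∀ b ∈ S, (b : ℝ) - a ≤ l) : (S.card : ℝ) ≤ l + 1 := by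
  rcases S.eq_empty_or_nonempty with rfl | hne
  · simp; linarith
  have hsub : S ⊆ Finset.Icc (S.min' hne) (S.min' hne + ⌊l⌋) := fun b hb => by
    refine Finset.mem_Icc.2 ⟨Finset.min'_le _ _ hb, ?_⟩
    have h1 := h _ (Finset.min'_mem S hne) b hb
    have h2 : b - S.min' hne ≤ ⌊l⌋ := Int.le_floor.2 (by push_cast; exact h1)
    linarith
  have h1 := Finset.card_le_card hsub
  rw [Int.card_Icc] at h1
  have h3 : 0 ≤ ⌊l⌋ := Int.floor_nonneg.2 hl
  have h2 : (S.card : ℤ) ≤ ⌊l⌋ + 1 := by omega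
  have h4 : (S.card : ℝ) ≤ ⌊l⌋ + 1 := by exact_mod_cast h2
  linarith [Int.floor_le l]

theorem card_nat_le_of_sub_le (S : Finset ℕ) {l : ℝ} (hl : 0 ≤ l)
    (h : ∀ a ∈ S, ∀ b ∈ S, (b : ℝ) - a ≤ l) : (S.card : ℝ) ≤ l + 1 := by
  rw [← Finset.card_map (Nat.castEmbedding (R := ℤ))]
  refine card_le_of_sub_le _ hl fun a ha b hb => ?_
  obtain ⟨x, hx, rfl⟩ := Finset.mem_map.1 ha
  obtain ⟨y, hy, rfl⟩ := Finset.mem_map.1 hb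
  simpa using h x hx y hy

/-- The squares beyond `M / 2` have gaps of order `√M`, so that an interval of length `H` contains
few of them. -/
theorem card_le_of_sq_mem_Ioc (S : Finset ℤ) {M Y H : ℝ} (hM : 0 < M) (hH : 0 ≤ H)
    (h : ∀ a ∈ S, Y < (a : ℝ) ^ 2 ∧ (a : ℝ) ^ 2 ≤ Y + H ∧ M ≤ 2 * (a : ℝ) ^ 2) :
    (S.card : ℝ) ≤ 2 * (H / √M + 1) := by
  classical
  have hs : 0 < √M := Real.sqrt_pos.2 hM
  have hsq : √M ^ 2 = M := Real.sq_sqrt hM.le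
  have half : ∀ T : Finset ℤ, (∀ a ∈ T, (Y < (a : ℝ) ^ 2 ∧ (a : ℝ) ^ 2 ≤ Y + H ∧
      M ≤ 2 * (a : ℝ) ^ 2) ∧ 0 ≤ (a : ℝ)) → (T.card : ℝ) ≤ H / √M + 1 := by
    intro T hT
    refine card_le_of_sub_le T (by positivity) fun a ha b hb => ?_
    obtain ⟨⟨a1, a2, a3⟩, a4⟩ := hT a ha
    obtain ⟨⟨b1, b2, b3⟩, b4⟩ := hT b hb
    rw [le_div_iff₀ hs]
    have hab : √M ≤ a + b := by
      refine abs_le_of_sq_le_sq' ?_ (by positivity) |>.2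
      nlinarith [mul_nonneg a4 b4]
    rcases le_or_gt (b : ℝ) a with hle | hlt
    · nlinarith
    · have : ((b : ℝ) - a) * √M ≤ (b - a) * (a + b) :=
        mul_le_mul_of_nonneg_left hab (by linarith)
      nlinarith
  have h1 := half (S.filter (0 ≤ ·)) fun a ha => by
    rw [Finset.mem_filter] at ha
    exact ⟨h a ha.1, by exact_mod_cast ha.2⟩
  have h2 := half ((S.filter (¬ 0 ≤ ·)).map (Equiv.neg ℤ).toEmbedding) fun a ha => by
    obtain ⟨b, hb, rfl⟩ := Finset.mem_map.1 ha
    rw [Finset.mem_filter] at hb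
    have h3 : (b : ℝ) < 0 := by exact_mod_cast not_le.1 hb.2
    have h4 := h b hb.1
    simp only [Equiv.coe_toEmbedding, Equiv.neg_apply, Int.cast_neg, neg_sq]
    exact ⟨h4, by linarith⟩
  rw [Finset.card_map] at h2
  have h3 := Finset.card_filter_add_card_filter_not (s := S) (fun x => 0 ≤ x)
  have h4 : (S.card : ℝ) = (S.filter (0 ≤ ·)).card + (S.filter (¬ 0 ≤ ·)).card := by
    exact_mod_cast h3.symm
  linarith

/-- A set of points of the plane, one coordinate of which is bounded by `2 √M`, while the square
of the other lies in an interval of length `Δ M` depending on the first. -/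
theorem card_le_of_slices (E : Finset (ℤ × ℤ)) {M Δ : ℝ} (hM : 1 < M) (hΔ : 0 < Δ) (Y : ℤ → ℝ)
    (h : ∀ p ∈ E, (p.1 : ℝ) ^ 2 ≤ 4 * M ∧ Y p.1 < (p.2 : ℝ) ^ 2 ∧
      (p.2 : ℝ) ^ 2 ≤ Y p.1 + Δ * M ∧ M ≤ 2 * (p.2 : ℝ) ^ 2) :
    (E.card : ℝ) ≤ 10 * (Δ * M + √M) := by
  classical
  have hM0 : 0 < M := by linarith
  have hs : 0 < √M := Real.sqrt_pos.2 hM0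
  have hsq : √M ^ 2 = M := Real.sq_sqrt hM0.le
  have hs1 : 1 ≤ √M := Real.one_le_sqrt.2 hM.le
  have hfib : ∀ b ∈ E.image Prod.fst, ((E.filter fun p => p.1 = b).card : ℝ) ≤
      2 * (Δ * M / √M + 1) := by
    intro b _
    have hinj : Set.InjOn Prod.snd ((E.filter fun p => p.1 = b : Finset (ℤ × ℤ)) : Set (ℤ × ℤ)) := by
      intro p hp q hq hpq
      exact Prod.ext ((Finset.mem_filter.1 hp).2.trans (Finset.mem_filter.1 hq).2.symm) hpq
    rw [← Finset.card_image_of_injOn hinj]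
    refine card_le_of_sq_mem_Ioc _ (Y := Y b) hM0 (by positivity) fun a ha => ?_
    obtain ⟨p, hp, rfl⟩ := Finset.mem_image.1 ha
    obtain ⟨hpE, rfl⟩ := Finset.mem_filter.1 hp
    exact (h p hpE).2
  have himg : ((E.image Prod.fst).card : ℝ) ≤ 5 * √M := by
    have h1 : ((E.image Prod.fst).card : ℝ) ≤ 4 * √M + 1 := by
      refine card_le_of_sub_le _ (by positivity) fun a ha b hb => ?_
      obtain ⟨p, hp, rfl⟩ := Finset.mem_image.1 ha
      obtain ⟨q, hq, rfl⟩ := Finset.mem_image.1 hb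
      have h2 : |(p.1 : ℝ)| ≤ 2 * √M := abs_le_of_sq_le_sq (by nlinarith [(h p hp).1]) (by positivity)
      have h3 : |(q.1 : ℝ)| ≤ 2 * √M := abs_le_of_sq_le_sq (by nlinarith [(h q hq).1]) (by positivity)
      rw [abs_le] at h2 h3
      linarith
    linarith
  have hsum : (E.card : ℝ) ≤ (E.image Prod.fst).card * (2 * (Δ * M / √M + 1)) := by
    rw [Finset.card_eq_sum_card_image Prod.fst E, Nat.cast_sum, ← nsmul_eq_mul]
    exact Finset.sum_le_card_nsmul _ _ _ hfib
  calc (E.card : ℝ) ≤ (E.image Prod.fst).card * (2 * (Δ * M / √M + 1)) := hsum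
    _ ≤ 5 * √M * (2 * (Δ * M / √M + 1)) :=
        mul_le_mul_of_nonneg_right himg (by positivity)
    _ = 10 * (Δ * M + √M) := by field_simp; ring

theorem mem_normBox {d : ℤ} {M Δ : ℝ} {w : Zsqrtd d} : w ∈ normBox d M Δ ↔
    IsOddElt w ∧ IsNormalized w ∧ M < (w.norm : ℝ) ∧ (w.norm : ℝ) ≤ M * (1 + Δ) := by
  rw [normBox, Set.Finite.mem_toFinset]; rfl

/-- The number of lattice points of the region defining `𝓡(M)` is bounded by the sum of its area
and its perimeter, up to a constant. -/
theorem card_normBox_le {d : ℤ} (hd : d = -1 ∨ d = 2) {M Δ : ℝ} (hM : 1 < M) (hΔ : 0 < Δ)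
    (hΔ1 : Δ < 1) : ((normBox d M Δ).card : ℝ) ≤ 20 * (Δ * M + √M) := by
  classical
  have hprop : ∀ w ∈ normBox d M Δ, M < (w.re : ℝ) ^ 2 - d * (w.im : ℝ) ^ 2 ∧
      (w.re : ℝ) ^ 2 - d * (w.im : ℝ) ^ 2 ≤ M + Δ * M ∧ (w.re : ℝ) ^ 2 ≤ 4 * M ∧
      (w.im : ℝ) ^ 2 ≤ 4 * M := by
    intro w hw
    obtain ⟨-, h2, h3, h4⟩ := mem_normBox.1 hw
    have e : (w.norm : ℝ) = (w.re : ℝ) ^ 2 - d * (w.im : ℝ) ^ 2 := by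
      rw [Zsqrtd.norm_def]; push_cast; ring
    have h5 : (w.re : ℝ) ^ 2 ≤ 2 * w.norm := by exact_mod_cast h2.isBalanced.re_sq_le
    have h6 : (w.im : ℝ) ^ 2 ≤ 2 * w.norm := by exact_mod_cast h2.isBalanced.im_sq_le
    have h7 : (w.norm : ℝ) ≤ 2 * M := by nlinarith
    rw [← e]
    exact ⟨h3, by linarith, by linarith, by linarith⟩
  let E₁ := ((normBox d M Δ).filter fun w => M ≤ 2 * (w.re : ℝ) ^ 2)
  let E₂ := ((normBox d M Δ).filter fun w => ¬ M ≤ 2 * (w.re : ℝ) ^ 2)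
  have h1 : (E₁.card : ℝ) ≤ 10 * (Δ * M + √M) := by
    have hinj : Set.InjOn (fun w : Zsqrtd d => (w.im, w.re)) (E₁ : Set (Zsqrtd d)) := by
      intro v _ w _ h
      rw [Prod.mk.injEq] at h
      exact Zsqrtd.ext h.2 h.1
    rw [← Finset.card_image_of_injOn hinj]
    refine card_le_of_slices _ hM hΔ (fun b => M + d * (b : ℝ) ^ 2) fun p hp => ?_
    obtain ⟨w, hw, rfl⟩ := Finset.mem_image.1 hp
    obtain ⟨hw1, hw2⟩ := Finset.mem_filter.1 hw
    obtain ⟨a1, a2, a3, a4⟩ := hprop w hw1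
    exact ⟨a4, by dsimp only; linarith, by dsimp only; linarith, hw2⟩
  have h2 : (E₂.card : ℝ) ≤ 10 * (Δ * M + √M) := by
    have hinj : Set.InjOn (fun w : Zsqrtd d => (w.re, w.im)) (E₂ : Set (Zsqrtd d)) := by
      intro v _ w _ h
      rw [Prod.mk.injEq] at h
      exact Zsqrtd.ext h.1 h.2
    rw [← Finset.card_image_of_injOn hinj]
    refine card_le_of_slices _ hM hΔ (fun a => M - (a : ℝ) ^ 2) fun p hp => ?_
    obtain ⟨w, hw, rfl⟩ := Finset.mem_image.1 hp
    obtain ⟨hw1, hw2⟩ := Finset.mem_filter.1 hw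
    obtain ⟨a1, a2, a3, a4⟩ := hprop w hw1
    -- For `d = 2` the first coordinate satisfies `a² > M`, so that this part is empty.
    rcases hd with rfl | rfl
    · push_cast at a1 a2
      exact ⟨a3, by dsimp only; linarith, by dsimp only; linarith, by dsimp only; linarith⟩
    · push_cast at a1 a2
      nlinarith [sq_nonneg (w.im : ℝ)]
  have h3 : ((normBox d M Δ).card : ℝ) = E₁.card + E₂.card := by
    exact_mod_cast (Finset.card_filter_add_card_filter_not (s := normBox d M Δ) _).symm
  linarith

/-- Elements with at most `f` prime factors are counted without a boundary term, since each norm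
is taken by boundedly many times `2 ^ f` of them. -/
theorem card_le_two_pow_mul {d : ℤ} (hd : d = -1 ∨ d = 2) {M Δ : ℝ} (hΔM : 1 ≤ Δ * M) (f : ℕ)
    (E : Finset (Zsqrtd d)) (hE : ∀ w ∈ E, w ∈ normBox d M Δ ∧ IsKernelElt w ∧
      AtMostPrimeFactors f w) : (E.card : ℝ) ≤ 338 * 2 ^ f * (Δ * M) := by
  classical
  have hfib : ∀ n ∈ E.image absNorm, (E.filter fun w => absNorm w = n).card ≤ 169 * 2 ^ f := by
    intro n hn
    obtain ⟨v, hv, rfl⟩ := Finset.mem_image.1 hn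
    refine (card_le_of_absNorm_eq hd (n := absNorm v) _ fun w hw => ?_).trans
      (Nat.mul_le_mul_left _ (Nat.pow_le_pow_right (by norm_num)
        (card_primeFactors_absNorm_le hd (hE v hv).2.1.primitive (hE v hv).2.2)))
    obtain ⟨hwE, hwn⟩ := Finset.mem_filter.1 hw
    exact ⟨(hE w hwE).2.1, (mem_normBox.1 (hE w hwE).1).2.1.isBalanced, hwn⟩
  have himg : ((E.image absNorm).card : ℝ) ≤ Δ * M + 1 := by
    refine card_nat_le_of_sub_le _ (by linarith) fun a ha b hb => ?_
    obtain ⟨v, hv, rfl⟩ := Finset.mem_image.1 ha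
    obtain ⟨w, hw, rfl⟩ := Finset.mem_image.1 hb
    have h1 : ((absNorm v : ℕ) : ℝ) = v.norm := by exact_mod_cast (hE v hv).2.1.natCast_absNorm
    have h2 : ((absNorm w : ℕ) : ℝ) = w.norm := by exact_mod_cast (hE w hw).2.1.natCast_absNorm
    have h3 := (mem_normBox.1 (hE v hv).1).2.2.1
    have h4 := (mem_normBox.1 (hE w hw).1).2.2.2
    rw [h1, h2]
    linarith
  have h1 : (E.card : ℝ) ≤ 169 * 2 ^ f * (E.image absNorm).card := by
    exact_mod_cast Finset.card_le_mul_card_image E _ hfib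
  calc (E.card : ℝ) ≤ 169 * 2 ^ f * (E.image absNorm).card := h1
    _ ≤ 169 * 2 ^ f * (2 * (Δ * M)) := by
        refine mul_le_mul_of_nonneg_left ?_ (by positivity)
        linarith
    _ = 338 * 2 ^ f * (Δ * M) := by ring

/-- There are `O(X ^ (1 + ε))` pairs of elements of norm at most `X` for which the product of
the norms is a square. -/
theorem exists_card_isSquare_le {d : ℤ} (hd : d = -1 ∨ d = 2) {ε : ℝ} (hε : 0 < ε) :
    ∃ C : ℝ, 0 < C ∧ ∀ (X : ℝ), 1 ≤ X → ∀ W : Finset (Zsqrtd d),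
      (∀ w ∈ W, IsKernelElt w ∧ IsBalanced w ∧ (absNorm w : ℝ) ≤ X) →
      ∀ D : Finset (Zsqrtd d × Zsqrtd d), (∀ p ∈ D, p.1 ∈ W ∧ p.2 ∈ W ∧
        IsSquare (absNorm p.1 * absNorm p.2)) → (D.card : ℝ) ≤ C * X ^ (1 + ε) := by
  classical
  obtain ⟨C, hC, hdiv⟩ := exists_card_divisors_le (ε := ε / 4) (by positivity)
  refine ⟨169 ^ 2 * C ^ 3, by positivity, fun X hX W hW D hD => ?_⟩
  have hX0 : 0 < X := by linarith
  have hfibE : ∀ n : ℕ, ((W.filter fun w => absNorm w = n).card : ℝ) ≤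
      169 * (C * X ^ (ε / 4)) := by
    intro n
    rcases (W.filter fun w => absNorm w = n).eq_empty_or_nonempty with h0 | ⟨v, hv⟩
    · rw [h0, Finset.card_empty, Nat.cast_zero]; positivity
    obtain ⟨hvW, rfl⟩ := Finset.mem_filter.1 hv
    have hn0 := (hW v hvW).1.absNorm_pos.ne'
    have h1 := card_le_of_absNorm_eq hd (n := absNorm v) (W.filter fun w => absNorm w = absNorm v)
      fun w hw => by
        obtain ⟨hwW, hwn⟩ := Finset.mem_filter.1 hw
        exact ⟨(hW w hwW).1, (hW w hwW).2.1, hwn⟩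
    have h2 := h1.trans (Nat.mul_le_mul_left _ (two_pow_card_primeFactors_le hn0))
    have h3 : ((W.filter fun w => absNorm w = absNorm v).card : ℝ) ≤
        169 * (absNorm v).divisors.card := by exact_mod_cast h2
    refine h3.trans (mul_le_mul_of_nonneg_left ((hdiv _ hn0).trans ?_) (by norm_num))
    refine mul_le_mul_of_nonneg_left ?_ (by positivity)
    exact Real.rpow_le_rpow (by positivity) (hW v hvW).2.2 (by positivity)
  -- A pair is counted according to the root `s` of the product and the norm of its first entry.
  let g : Zsqrtd d × Zsqrtd d → Σ _ : ℕ, ℕ := fun p =>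
    ⟨(absNorm p.1 * absNorm p.2).sqrt, absNorm p.1⟩
  have hgs : ∀ p ∈ D, (absNorm p.1 * absNorm p.2).sqrt ^ 2 = absNorm p.1 * absNorm p.2 := by
    intro p hp
    obtain ⟨-, -, s, hs⟩ := hD p hp
    rw [hs, Nat.sqrt_eq, sq]
  have hfib : ∀ q ∈ D.image g, ((D.filter fun p => g p = q).card : ℝ) ≤
      (169 * (C * X ^ (ε / 4))) ^ 2 := by
    intro q hq
    obtain ⟨p₀, hp₀, rfl⟩ := Finset.mem_image.1 hq
    have hsub : (D.filter fun p => g p = g p₀) ⊆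
        (W.filter fun w => absNorm w = absNorm p₀.1) ×ˢ
          (W.filter fun w => absNorm w = absNorm p₀.2) := by
      intro p hp
      obtain ⟨hpD, hpg⟩ := Finset.mem_filter.1 hp
      simp only [g, Sigma.mk.injEq, heq_eq_eq] at hpg
      have h1 := hgs p hpD
      have h2 := hgs p₀ hp₀
      rw [hpg.1, h2, hpg.2] at h1
      have h3 := Nat.eq_of_mul_eq_mul_left (hW _ (hD p₀ hp₀).1).1.absNorm_pos h1
      rw [Finset.mem_product, Finset.mem_filter, Finset.mem_filter]
      exact ⟨⟨(hD p hpD).1, hpg.2⟩, ⟨(hD p hpD).2.1, h3.symm⟩⟩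
    have h1 := Finset.card_le_card hsub
    rw [Finset.card_product] at h1
    have h2 : ((D.filter fun p => g p = g p₀).card : ℝ) ≤
        (W.filter fun w => absNorm w = absNorm p₀.1).card *
          (W.filter fun w => absNorm w = absNorm p₀.2).card := by exact_mod_cast h1
    refine h2.trans ?_
    rw [sq]
    exact mul_le_mul (hfibE _) (hfibE _) (by positivity) (by positivity)
  have himg : ((D.image g).card : ℝ) ≤ X * (C * X ^ (ε / 2)) := by
    have hsub : D.image g ⊆ (Finset.Icc 1 ⌊X⌋₊).sigma fun s => (s ^ 2).divisors := by
      intro q hq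
      obtain ⟨p, hp, rfl⟩ := Finset.mem_image.1 hq
      obtain ⟨p1, p2, -⟩ := hD p hp
      have h1 := hgs p hp
      have hpos : 0 < absNorm p.1 * absNorm p.2 :=
        Nat.mul_pos (hW _ p1).1.absNorm_pos (hW _ p2).1.absNorm_pos
      refine Finset.mem_sigma.2 ⟨Finset.mem_Icc.2 ⟨Nat.sqrt_pos.2 hpos, Nat.le_floor ?_⟩, ?_⟩
      · refine abs_le_of_sq_le_sq' ?_ hX0.le |>.2
        have : ((absNorm p.1 * absNorm p.2).sqrt : ℝ) ^ 2 = absNorm p.1 * absNorm p.2 := by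
          exact_mod_cast h1
        dsimp only [g]
        rw [this, sq]
        exact mul_le_mul (hW _ p1).2.2 (hW _ p2).2.2 (by positivity) hX0.le
      · dsimp only [g]
        rw [h1, Nat.mem_divisors]
        exact ⟨dvd_mul_right _ _, hpos.ne'⟩
    have h1 := Finset.card_le_card hsub
    rw [Finset.card_sigma] at h1
    have h2 : ((D.image g).card : ℝ) ≤ ∑ s ∈ Finset.Icc 1 ⌊X⌋₊, ((s ^ 2).divisors.card : ℝ) := by
      exact_mod_cast h1
    refine h2.trans ((Finset.sum_le_card_nsmul _ _ (C * X ^ (ε / 2)) fun s hs => ?_).trans ?_)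
    · obtain ⟨hs1, hs2⟩ := Finset.mem_Icc.1 hs
      have hsX : (s : ℝ) ≤ X := (Nat.le_floor_iff hX0.le).1 hs2
      refine (hdiv _ (pow_ne_zero 2 (by omega))).trans
        (mul_le_mul_of_nonneg_left ?_ (by positivity))
      rw [show ε / 2 = (2 : ℕ) * (ε / 4) by push_cast; ring, Real.rpow_mul hX0.le,
        Real.rpow_natCast, Nat.cast_pow]
      exact Real.rpow_le_rpow (by positivity) (pow_le_pow_left₀ (by positivity) hsX 2)
        (by positivity)
    · rw [Nat.card_Icc, nsmul_eq_mul, add_tsub_cancel_right]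
      exact mul_le_mul_of_nonneg_right (Nat.floor_le hX0.le) (by positivity)
  have hsum : (D.card : ℝ) ≤ (D.image g).card * (169 * (C * X ^ (ε / 4))) ^ 2 := by
    rw [Finset.card_eq_sum_card_image g D, Nat.cast_sum, ← nsmul_eq_mul]
    exact Finset.sum_le_card_nsmul _ _ _ hfib
  refine hsum.trans ((mul_le_mul_of_nonneg_right himg (by positivity)).trans_eq ?_)
  have e : X ^ (1 + ε) = X * X ^ (ε / 2) * (X ^ (ε / 4)) ^ 2 := by
    rw [← Real.rpow_natCast, ← Real.rpow_mul hX0.le, mul_assoc, ← Real.rpow_add hX0,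
      ← Real.rpow_one_add' hX0.le (by positivity)]
    congr 1; push_cast; ring
  rw [e]; ring

open Classical in
/-- An element has `O(X ^ ε)` representations as a product of `k` elements of norm at most `X`. -/
theorem exists_card_prod_eq_le {d : ℤ} (hd : d = -1 ∨ d = 2) (k : ℕ) {ε : ℝ} (hε : 0 < ε) :
    ∃ C : ℝ, 0 < C ∧ ∀ (X : ℝ), 1 ≤ X → ∀ Z : Finset (Zsqrtd d),
      (∀ z ∈ Z, IsKernelElt z ∧ IsBalanced z ∧ (absNorm z : ℝ) ≤ X) → ∀ ζ : Zsqrtd d,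
      (((Fintype.piFinset (fun _ : Fin k => Z)).filter fun g => ∏ i, g i = ζ).card : ℝ) ≤
        C * X ^ ε := by
  set δ : ℝ := ε / (2 * k ^ 2 + 1) with hδ
  have hδ0 : 0 < δ := by positivity
  obtain ⟨C, hC, hdiv⟩ := exists_card_divisors_le hδ0
  refine ⟨(169 * C ^ 2) ^ k, by positivity, fun X hX Z hZ ζ => ?_⟩
  have hX0 : 0 < X := by linarith
  rcases ((Fintype.piFinset (fun _ : Fin k => Z)).filter
    fun g => ∏ i, g i = ζ).eq_empty_or_nonempty with h0 | ⟨g₀, hg₀⟩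
  · rw [h0, Finset.card_empty, Nat.cast_zero]; positivity
  obtain ⟨hg₀Z, rfl⟩ := Finset.mem_filter.1 hg₀
  rw [Fintype.mem_piFinset] at hg₀Z
  have hmul : ∀ g : Fin k → Zsqrtd d, absNorm (∏ i, g i) = ∏ i, absNorm (g i) := fun g => by
    let φ : Zsqrtd d →* ℕ :=
      { toFun := absNorm, map_one' := by simp [absNorm], map_mul' := absNorm_mul }
    exact map_prod φ g Finset.univ
  set m := absNorm (∏ i, g₀ i) with hm
  have hm0 : m ≠ 0 := by
    rw [hm, hmul, Finset.prod_ne_zero_iff]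
    exact fun i _ => (hZ _ (hg₀Z i)).1.absNorm_pos.ne'
  have hmX : (m : ℝ) ≤ X ^ k := by
    rw [hm, hmul, Nat.cast_prod]
    refine (Finset.prod_le_prod (fun _ _ => by positivity)
      fun i _ => (hZ _ (hg₀Z i)).2.2).trans_eq ?_
    rw [Finset.prod_const, Finset.card_univ, Fintype.card_fin]
  let Z' := Z.filter fun z => absNorm z ∣ m
  have hdivle : ∀ n : ℕ, n ∣ m → (n.divisors.card : ℝ) ≤ C * X ^ (k * δ) := by
    intro n hn
    have hn0 : n ≠ 0 := ne_zero_of_dvd_ne_zero hm0 hn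
    refine (hdiv n hn0).trans (mul_le_mul_of_nonneg_left ?_ (by positivity))
    rw [Real.rpow_mul hX0.le, Real.rpow_natCast]
    refine Real.rpow_le_rpow (by positivity) (le_trans ?_ hmX) hδ0.le
    exact_mod_cast Nat.le_of_dvd (Nat.pos_of_ne_zero hm0) hn
  have hZ' : (Z'.card : ℝ) ≤ 169 * C ^ 2 * X ^ (2 * k * δ) := by
    have hsum : (Z'.card : ℝ) ≤ (Z'.image absNorm).card * (169 * (C * X ^ (k * δ))) := by
      rw [Finset.card_eq_sum_card_image absNorm Z', Nat.cast_sum, ← nsmul_eq_mul]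
      refine Finset.sum_le_card_nsmul _ _ _ fun n hn => ?_
      obtain ⟨v, hv, rfl⟩ := Finset.mem_image.1 hn
      obtain ⟨hvZ, hvm⟩ := Finset.mem_filter.1 hv
      have h1 := card_le_of_absNorm_eq hd (n := absNorm v)
        (Z'.filter fun w => absNorm w = absNorm v) fun w hw => by
          obtain ⟨hwZ', hwn⟩ := Finset.mem_filter.1 hw
          have hwZ := (Finset.mem_filter.1 hwZ').1
          exact ⟨(hZ w hwZ).1, (hZ w hwZ).2.1, hwn⟩
      have h2 := h1.trans (Nat.mul_le_mul_left _
        (two_pow_card_primeFactors_le (hZ v hvZ).1.absNorm_pos.ne'))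
      have h3 : ((Z'.filter fun w => absNorm w = absNorm v).card : ℝ) ≤
        169 * (absNorm v).divisors.card := by exact_mod_cast h2
      exact h3.trans (mul_le_mul_of_nonneg_left (hdivle _ hvm) (by norm_num))
    have himg : ((Z'.image absNorm).card : ℝ) ≤ C * X ^ (k * δ) := by
      refine le_trans ?_ (hdivle m dvd_rfl)
      have : Z'.image absNorm ⊆ m.divisors := fun n hn => by
        obtain ⟨v, hv, rfl⟩ := Finset.mem_image.1 hn
        exact Nat.mem_divisors.2 ⟨(Finset.mem_filter.1 hv).2, hm0⟩
      exact_mod_cast Finset.card_le_card this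
    refine hsum.trans ((mul_le_mul_of_nonneg_right himg (by positivity)).trans_eq ?_)
    rw [show 2 * (k : ℝ) * δ = k * δ + k * δ by ring, Real.rpow_add hX0]
    ring
  have hsub : ((Fintype.piFinset (fun _ : Fin k => Z)).filter
      fun g => ∏ i, g i = ∏ i, g₀ i) ⊆ Fintype.piFinset (fun _ : Fin k => Z') := by
    intro g hg
    obtain ⟨hgZ, hgp⟩ := Finset.mem_filter.1 hg
    rw [Fintype.mem_piFinset] at hgZ ⊢
    refine fun i => Finset.mem_filter.2 ⟨hgZ i, ?_⟩
    rw [hm, ← hgp, hmul]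
    exact Finset.dvd_prod_of_mem _ (Finset.mem_univ i)
  have h1 := Finset.card_le_card hsub
  rw [Fintype.card_piFinset, Finset.prod_const, Finset.card_univ, Fintype.card_fin] at h1
  have h2 : (((Fintype.piFinset (fun _ : Fin k => Z)).filter
      fun g => ∏ i, g i = ∏ i, g₀ i).card : ℝ) ≤ (Z'.card : ℝ) ^ k := by exact_mod_cast h1
  refine h2.trans ((pow_le_pow_left₀ (by positivity) hZ' k).trans ?_)
  rw [mul_pow, ← Real.rpow_natCast (X ^ _), ← Real.rpow_mul hX0.le]
  refine mul_le_mul_of_nonneg_left (Real.rpow_le_rpow_of_exponent_le hX ?_) (by positivity)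
  have e : 2 * k * δ * k = 2 * k ^ 2 * δ := by ring
  have e2 : ε = (2 * k ^ 2 + 1) * δ := by rw [hδ]; field_simp
  rw [e, e2]
  linarith

/-! ### The bilinear bound -/

theorem norm_le_of_mem_normBox {d : ℤ} {M Δ : ℝ} (hM : 0 < M) (hΔ1 : Δ < 1) {w : Zsqrtd d}
    (hw : w ∈ normBox d M Δ) : (w.norm : ℝ) ≤ 2 * M := by
  have := (mem_normBox.1 hw).2.2.2
  nlinarith

theorem abs_coord_le_of_mem_normBox {d : ℤ} {M Δ : ℝ} (hM : 0 < M) (hΔ1 : Δ < 1) {w : Zsqrtd d}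
    (hw : w ∈ normBox d M Δ) : |(w.re : ℝ)| ≤ 2 * √M ∧ |(w.im : ℝ)| ≤ 2 * √M := by
  have h1 := norm_le_of_mem_normBox hM hΔ1 hw
  have hb := (mem_normBox.1 hw).2.1.isBalanced
  have h2 : (w.re : ℝ) ^ 2 ≤ 2 * w.norm := by exact_mod_cast hb.re_sq_le
  have h3 : (w.im : ℝ) ^ 2 ≤ 2 * w.norm := by exact_mod_cast hb.im_sq_le
  have h4 : √M ^ 2 = M := Real.sq_sqrt hM.le
  exact ⟨abs_le_of_sq_le_sq (by nlinarith) (by positivity),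
    abs_le_of_sq_le_sq (by nlinarith) (by positivity)⟩

theorem abs_re_mul_le {d : ℤ} (hd : d = -1 ∨ d = 2) {v w : Zsqrtd d} {A B : ℝ} (hA : 0 ≤ A)
    (h1 : |(v.re : ℝ)| ≤ A) (h2 : |(v.im : ℝ)| ≤ A) (h3 : |(w.re : ℝ)| ≤ B)
    (h4 : |(w.im : ℝ)| ≤ B) :
    |((v * w).re : ℝ)| ≤ 3 * A * B ∧ |((v * w).im : ℝ)| ≤ 2 * A * B := by
  have hd' : |(d : ℝ)| ≤ 2 := by rcases hd with rfl | rfl <;> norm_num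
  rw [Zsqrtd.re_mul, Zsqrtd.im_mul]
  push_cast
  have m1 : |(v.re : ℝ)| * |(w.re : ℝ)| ≤ A * B := mul_le_mul h1 h3 (abs_nonneg _) hA
  have m2 : |(v.im : ℝ)| * |(w.im : ℝ)| ≤ A * B := mul_le_mul h2 h4 (abs_nonneg _) hA
  have m3 : |(v.re : ℝ)| * |(w.im : ℝ)| ≤ A * B := mul_le_mul h1 h4 (abs_nonneg _) hA
  have m4 : |(v.im : ℝ)| * |(w.re : ℝ)| ≤ A * B := mul_le_mul h2 h3 (abs_nonneg _) hA
  constructor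
  · refine (abs_add_le _ _).trans ?_
    rw [abs_mul, abs_mul, abs_mul, mul_assoc |(d : ℝ)|]
    have : |(d : ℝ)| * (|(v.im : ℝ)| * |(w.im : ℝ)|) ≤ 2 * (A * B) :=
      mul_le_mul hd' m2 (by positivity) (by norm_num)
    linarith
  · refine (abs_add_le _ _).trans ?_
    rw [abs_mul, abs_mul]
    linarith

theorem abs_coord_prod_le {d : ℤ} (hd : d = -1 ∨ d = 2) {ι : Type*} (s : Finset ι)
    (g : ι → Zsqrtd d) {A : ℝ} (hA : 0 ≤ A)
    (hg : ∀ i ∈ s, |((g i).re : ℝ)| ≤ A ∧ |((g i).im : ℝ)| ≤ A) :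
    |((∏ i ∈ s, g i).re : ℝ)| ≤ (3 * A) ^ s.card ∧
      |((∏ i ∈ s, g i).im : ℝ)| ≤ (3 * A) ^ s.card := by
  classical
  induction s using Finset.induction_on with
  | empty => simp
  | insert i s hi ih =>
    obtain ⟨h1, h2⟩ := hg i (Finset.mem_insert_self _ _)
    obtain ⟨h3, h4⟩ := ih fun j hj => hg j (Finset.mem_insert_of_mem hj)
    rw [Finset.prod_insert hi, Finset.card_insert_of_notMem hi, pow_succ']
    obtain ⟨h5, h6⟩ := abs_re_mul_le hd hA h1 h2 h3 h4
    refine ⟨h5, h6.trans ?_⟩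
    have : 0 ≤ A * (3 * A) ^ s.card := by positivity
    linarith

open Classical in
/-- The estimate obtained from the `k`-th power of the inner sum, for elements of norm in
`(M, M (1 + Δ)]` and `(N, N (1 + Δ)]`. -/
theorem norm_kernel_sum_pow_le_of_normBox {d : ℤ} (hd : d = -1 ∨ d = 2) {k : ℕ} (hk : k ≠ 0)
    {M N Δ D B : ℝ} (hM : 1 < M) (hN : 1 < N) (hΔ1 : Δ < 1)
    (W Z : Finset (Zsqrtd d)) (hW : ∀ w ∈ W, w ∈ normBox d M Δ ∧ IsKernelElt w)
    (hZ : ∀ z ∈ Z, z ∈ normBox d N Δ)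
    (hD : (((W ×ˢ W).filter fun p => IsSquare (absNorm p.1 * absNorm p.2)).card : ℝ) ≤ D)
    (hB : ∀ ζ : Zsqrtd d,
      (((Fintype.piFinset (fun _ : Fin k => Z)).filter fun g => ∏ i, g i = ζ).card : ℝ) ≤ B)
    (α β : Zsqrtd d → ℂ) (hα : ∀ w ∈ W, ‖α w‖ ≤ 1) (hβ : ∀ z ∈ Z, ‖β z‖ ≤ 1) :
    ‖∑ w ∈ W, ∑ z ∈ Z, α w * β z * (kernel w z : ℂ)‖ ^ (2 * k) ≤
      (W.card : ℝ) ^ (2 * k - 2) * (Z.card : ℝ) ^ k * B *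
      (D * (3 * (6 * √N) ^ k) ^ 2 + (W.card : ℝ) ^ 2 * (4 * (3 * (6 * √N) ^ k) * (20 * M))) := by
  have hM0 : 0 < M := by linarith
  have hN0 : 0 < N := by linarith
  have hsN : 1 ≤ √N := Real.one_le_sqrt.2 hN.le
  have hD0 : 0 ≤ D := le_trans (Nat.cast_nonneg _) hD
  have hB0 : 0 ≤ B := le_trans (Nat.cast_nonneg _) (hB 0)
  set L : ℕ := ⌊(6 * √N) ^ k⌋₊ with hL
  have hLle : (2 * L + 1 : ℝ) ≤ 3 * (6 * √N) ^ k := by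
    have h1 : (L : ℝ) ≤ (6 * √N) ^ k := Nat.floor_le (by positivity)
    have h2 : 1 ≤ (6 * √N) ^ k := one_le_pow₀ (by linarith)
    linarith
  have key := norm_kernel_sum_pow_le hd k L ⌊B⌋₊ hk (G := 20 * M) W Z (fun w hw => (hW w hw).2)
    ?_ ?_ ?_ α β hα hβ
  · refine key.trans ?_
    have h1 : ((⌊B⌋₊ : ℕ) : ℝ) ≤ B := Nat.floor_le hB0
    gcongr
  · intro v hv w hw
    obtain ⟨a1, a2⟩ := abs_coord_le_of_mem_normBox hM0 hΔ1 (hW v hv).1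
    obtain ⟨a3, a4⟩ := abs_coord_le_of_mem_normBox hM0 hΔ1 (hW w hw).1
    obtain ⟨a5, a6⟩ := abs_re_mul_le hd (by positivity) a1 a2 a3 a4
    have : √M * √M = M := Real.mul_self_sqrt hM0.le
    nlinarith
  · intro g hg
    rw [Fintype.mem_piFinset] at hg
    obtain ⟨a1, a2⟩ := abs_coord_prod_le hd Finset.univ g (A := 2 * √N) (by positivity)
      fun i _ => abs_coord_le_of_mem_normBox hN0 hΔ1 (hZ _ (hg i))
    rw [Finset.card_univ, Fintype.card_fin, show 3 * (2 * √N) = 6 * √N by ring] at a1 a2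
    have natle : ∀ a : ℤ, |(a : ℝ)| ≤ (6 * √N) ^ k → |a| ≤ (L : ℤ) := by
      intro a ha
      have h1 : a.natAbs ≤ L := by
        rw [hL]
        refine Nat.le_floor ?_
        rwa [Nat.cast_natAbs, Int.cast_abs]
      rw [Int.abs_eq_natAbs]
      exact_mod_cast h1
    exact mem_box.2 ⟨natle _ a1, natle _ a2⟩
  · exact fun ζ => Nat.le_floor (hB ζ)

theorem le_mul_of_pow_le_mul_pow {x c y : ℝ} {n : ℕ} (hn : n ≠ 0) (hc : 1 ≤ c) (hy : 0 ≤ y)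
    (h : x ^ n ≤ c * y ^ n) : x ≤ c * y := by
  refine le_of_pow_le_pow_left₀ hn (by positivity) (h.trans ?_)
  rw [mul_pow]
  exact mul_le_mul_of_nonneg_right (le_self_pow₀ hc hn) (by positivity)

/-- The bilinear bound when `w` runs over the shorter range. Powers of `1 / 12` are avoided by
writing `Δ = δ ^ 12`, `M = μ ^ 12`, `N = ν ^ 12`. -/
theorem exists_norm_kernel_sum_le {d : ℤ} (hd : d = -1 ∨ d = 2) :
    ∃ C : ℝ, 0 < C ∧ ∀ (f : ℕ) (δ μ ν : ℝ), 0 < δ → δ < 1 → 1 < μ → μ ≤ ν → 1 ≤ δ * μ →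
      ∀ (W Z : Finset (Zsqrtd d)),
      (∀ w ∈ W, w ∈ normBox d (μ ^ 12) (δ ^ 12) ∧ IsKernelElt w) →
      (∀ z ∈ Z, z ∈ normBox d (ν ^ 12) (δ ^ 12) ∧ IsKernelElt z ∧ AtMostPrimeFactors f z) →
      ∀ α β : Zsqrtd d → ℂ, (∀ w ∈ W, ‖α w‖ ≤ 1) → (∀ z ∈ Z, ‖β z‖ ≤ 1) →
      ‖∑ w ∈ W, ∑ z ∈ Z, α w * β z * (kernel w z : ℂ)‖ ≤
        C * 2 ^ f * (δ ^ 13 * μ ^ 11 * ν ^ 12) := by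
  classical
  obtain ⟨C₁, hC₁, hsq⟩ := exists_card_isSquare_le hd (ε := 1 / 12) (by norm_num)
  obtain ⟨C₂, hC₂, hpr⟩ := exists_card_prod_eq_le hd 4 (ε := 1 / 12) (by norm_num)
  set c₁ : ℝ := 40 * (4 * C₁ * 18 ^ 2 + 40 ^ 2 * (4 * 18 * 20)) with hc₁
  set c₂ : ℝ := 40 ^ 6 * 40 ^ 4 * (2 * C₂) *
    (4 * C₁ * 3888 ^ 2 + 40 ^ 2 * (4 * 3888 * 20)) with hc₂
  have hc₁0 : 0 < c₁ := by positivity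
  have hc₂0 : 0 < c₂ := by positivity
  refine ⟨13520 + (1 + c₁) + (1 + c₂), by positivity, ?_⟩
  intro f δ μ ν hδ hδ1 hμ hμν hδμ W Z hW hZ α β hα hβ
  have hμ0 : 0 < μ := by linarith
  have hν : 1 < ν := by linarith
  have hν0 : 0 < ν := by linarith
  have hM1 : 1 < μ ^ 12 := one_lt_pow₀ hμ (by norm_num)
  have hN1 : 1 < ν ^ 12 := one_lt_pow₀ hν (by norm_num)
  have hΔ0 : 0 < δ ^ 12 := by positivity
  have hΔ1 : δ ^ 12 < 1 := pow_lt_one₀ hδ.le hδ1 (by norm_num)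
  have hsM : √(μ ^ 12) = μ ^ 6 := by
    rw [show μ ^ 12 = (μ ^ 6) ^ 2 by ring]; exact Real.sqrt_sq (by positivity)
  have hsN : √(ν ^ 12) = ν ^ 6 := by
    rw [show ν ^ 12 = (ν ^ 6) ^ 2 by ring]; exact Real.sqrt_sq (by positivity)
  have hP : (W.card : ℝ) ≤ 20 * (δ ^ 12 * μ ^ 12 + μ ^ 6) := by
    rw [← hsM]
    refine le_trans ?_ (card_normBox_le hd hM1 hΔ0 hΔ1)
    exact_mod_cast Finset.card_le_card fun w hw => (hW w hw).1
  have hQ : (Z.card : ℝ) ≤ 20 * (δ ^ 12 * ν ^ 12 + ν ^ 6) := by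
    rw [← hsN]
    refine le_trans ?_ (card_normBox_le hd hN1 hΔ0 hΔ1)
    exact_mod_cast Finset.card_le_card fun w hw => (hZ w hw).1
  have h2f : (1 : ℝ) ≤ 2 ^ f := one_le_pow₀ (by norm_num)
  have hY : 0 < δ ^ 13 * μ ^ 11 * ν ^ 12 := by positivity
  -- A bound with a smaller constant and without the factor `2 ^ f` suffices.
  have fin : ∀ c : ℝ, 0 ≤ c → c ≤ 13520 + (1 + c₁) + (1 + c₂) →
      ‖∑ w ∈ W, ∑ z ∈ Z, α w * β z * (kernel w z : ℂ)‖ ≤ c * (δ ^ 13 * μ ^ 11 * ν ^ 12) →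
      ‖∑ w ∈ W, ∑ z ∈ Z, α w * β z * (kernel w z : ℂ)‖ ≤
        (13520 + (1 + c₁) + (1 + c₂)) * 2 ^ f * (δ ^ 13 * μ ^ 11 * ν ^ 12) := by
    intro c hc hcle h
    refine h.trans (mul_le_mul_of_nonneg_right ?_ hY.le)
    exact hcle.trans (le_mul_of_one_le_right (by positivity) h2f)
  rcases le_total (δ ^ 11 * μ) 1 with hcase | hcase
  · -- For very thin regions the trivial bound is enough.
    have h1 : δ ^ 12 * μ ^ 12 ≤ δ * μ ^ 11 := by
      calc δ ^ 12 * μ ^ 12 = (δ ^ 11 * μ) * (δ * μ ^ 11) := by ring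
        _ ≤ 1 * (δ * μ ^ 11) := by gcongr
        _ = _ := one_mul _
    have h2 : μ ^ 6 ≤ δ * μ ^ 11 := by
      calc μ ^ 6 = 1 * 1 * μ ^ 6 := by ring
        _ ≤ (δ * μ) * μ ^ 4 * μ ^ 6 := by
            gcongr
            exact one_le_pow₀ hμ.le
        _ = _ := by ring
    have hP' : (W.card : ℝ) ≤ 40 * (δ * μ ^ 11) := by linarith
    have hΔN : 1 ≤ δ ^ 12 * ν ^ 12 := by
      rw [← mul_pow]
      exact one_le_pow₀ (hδμ.trans (mul_le_mul_of_nonneg_left hμν hδ.le))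
    have hQ' := card_le_two_pow_mul hd hΔN f Z hZ
    have htriv : ‖∑ w ∈ W, ∑ z ∈ Z, α w * β z * (kernel w z : ℂ)‖ ≤ W.card * Z.card := by
      rw [← nsmul_eq_mul]
      refine (norm_sum_le _ _).trans (Finset.sum_le_card_nsmul _ _ _ fun w hw => ?_)
      rw [← mul_one (Z.card : ℝ), ← nsmul_eq_mul]
      refine (norm_sum_le _ _).trans (Finset.sum_le_card_nsmul _ _ _ fun z hz => ?_)
      rw [norm_mul, norm_mul]
      have h3 : ‖(kernel w z : ℂ)‖ ≤ 1 := by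
        rw [Complex.norm_intCast]
        exact_mod_cast abs_kernel_le_one w z
      exact mul_le_one₀ (mul_le_one₀ (hα w hw) (norm_nonneg _) (hβ z hz)) (norm_nonneg _) h3
    calc ‖∑ w ∈ W, ∑ z ∈ Z, α w * β z * (kernel w z : ℂ)‖ ≤ W.card * Z.card := htriv
      _ ≤ 40 * (δ * μ ^ 11) * (338 * 2 ^ f * (δ ^ 12 * ν ^ 12)) := by gcongr
      _ = 13520 * 2 ^ f * (δ ^ 13 * μ ^ 11 * ν ^ 12) := by ring
      _ ≤ _ := by
          gcongr
          linarith
  -- Otherwise the areas dominate the perimeters.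
  have hδ2 : ∀ x : ℝ, μ ≤ x → x ^ 6 ≤ δ ^ 12 * x ^ 12 := by
    intro x hx
    have h1 : 1 ≤ δ ^ 2 * x := by
      refine hcase.trans (mul_le_mul ?_ hx hμ0.le (by positivity))
      exact pow_le_pow_of_le_one hδ.le hδ1.le (by norm_num)
    calc x ^ 6 = 1 * x ^ 6 := (one_mul _).symm
      _ ≤ (δ ^ 2 * x) ^ 6 * x ^ 6 :=
          mul_le_mul_of_nonneg_right (one_le_pow₀ h1) (pow_nonneg (hμ0.le.trans hx) 6)
      _ = _ := by ring
  have hP' : (W.card : ℝ) ≤ 40 * (δ ^ 12 * μ ^ 12) := by linarith [hδ2 μ le_rfl]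
  have hQ' : (Z.card : ℝ) ≤ 40 * (δ ^ 12 * ν ^ 12) := by linarith [hδ2 ν hμν]
  have hrpow : ∀ x : ℝ, 0 < x → (x ^ 12) ^ (1 / 12 : ℝ) = x := by
    intro x hx
    rw [← Real.rpow_natCast, ← Real.rpow_mul hx.le]
    norm_num
  have htwo : (2 : ℝ) ^ (1 / 12 : ℝ) ≤ 2 := by
    calc (2 : ℝ) ^ (1 / 12 : ℝ) ≤ (2 : ℝ) ^ (1 : ℝ) :=
          Real.rpow_le_rpow_of_exponent_le (by norm_num) (by norm_num)
      _ = 2 := Real.rpow_one 2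
  have hrpow2 : ∀ x : ℝ, 0 < x → (2 * x ^ 12) ^ (1 / 12 : ℝ) ≤ 2 * x := by
    intro x hx
    rw [Real.mul_rpow (by norm_num) (by positivity), hrpow x hx]
    exact mul_le_mul_of_nonneg_right htwo hx.le
  have hWX : ∀ w ∈ W, IsKernelElt w ∧ IsBalanced w ∧ (absNorm w : ℝ) ≤ 2 * μ ^ 12 := by
    intro w hw
    obtain ⟨h1, h2⟩ := hW w hw
    refine ⟨h2, (mem_normBox.1 h1).2.1.isBalanced, ?_⟩
    have h3 : ((absNorm w : ℕ) : ℝ) = w.norm := by exact_mod_cast h2.natCast_absNorm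
    rw [h3]
    exact norm_le_of_mem_normBox (by positivity) hΔ1 h1
  have hZX : ∀ z ∈ Z, IsKernelElt z ∧ IsBalanced z ∧ (absNorm z : ℝ) ≤ 2 * ν ^ 12 := by
    intro w hw
    obtain ⟨h1, h2, -⟩ := hZ w hw
    refine ⟨h2, (mem_normBox.1 h1).2.1.isBalanced, ?_⟩
    have h3 : ((absNorm w : ℕ) : ℝ) = w.norm := by exact_mod_cast h2.natCast_absNorm
    rw [h3]
    exact norm_le_of_mem_normBox (by positivity) hΔ1 h1
  have hD : (((W ×ˢ W).filter fun p => IsSquare (absNorm p.1 * absNorm p.2)).card : ℝ) ≤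
      4 * C₁ * μ ^ 13 := by
    refine (hsq (2 * μ ^ 12) (by linarith) W hWX _ fun p hp => ?_).trans ?_
    · rw [Finset.mem_filter, Finset.mem_product] at hp
      exact ⟨hp.1.1, hp.1.2, hp.2⟩
    · rw [Real.rpow_add (by positivity), Real.rpow_one]
      calc C₁ * (2 * μ ^ 12 * (2 * μ ^ 12) ^ (1 / 12 : ℝ))
          ≤ C₁ * (2 * μ ^ 12 * (2 * μ)) := by
            have := hrpow2 μ hμ0
            gcongr
        _ = 4 * C₁ * μ ^ 13 := by ring
  rcases le_total (μ ^ 3) ν with hlong | hshort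
  · -- The range of `z` is so long that the first power suffices.
    have key := norm_kernel_sum_pow_le_of_normBox hd (k := 1) one_ne_zero (B := 1) hM1 hN1 hΔ1 W Z
      hW (fun z hz => (hZ z hz).1) hD (fun ζ => by
        rw [← Nat.cast_one (R := ℝ), Nat.cast_le, Finset.card_le_one]
        intro g hg g' hg'
        have h1 := (Finset.mem_filter.1 hg).2
        have h2 := (Finset.mem_filter.1 hg').2
        rw [Fin.prod_univ_one] at h1 h2
        funext i
        rw [Subsingleton.elim i 0, h1, h2]) α β hα hβ
    refine fin (1 + c₁) (by linarith) (by linarith) ?_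
    refine le_mul_of_pow_le_mul_pow (n := 2) two_ne_zero (by linarith) hY.le ?_
    rw [hsN] at key
    have e1 : μ ^ 13 ≤ δ ^ 14 * μ ^ 22 := by
      have h1 : 1 ≤ δ * μ := hδμ
      calc μ ^ 13 = 1 * 1 * μ ^ 13 := by ring
        _ ≤ (δ ^ 11 * μ) * ((δ * μ) ^ 3 * μ ^ 5) * μ ^ 13 := by
            gcongr
            exact one_le_mul_of_one_le_of_one_le (one_le_pow₀ h1) (one_le_pow₀ hμ.le)
        _ = _ := by ring
    have e2 : δ ^ 24 * μ ^ 36 ≤ δ ^ 14 * μ ^ 22 * ν ^ 6 := by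
      have h1 : δ ^ 24 ≤ δ ^ 14 := pow_le_pow_of_le_one hδ.le hδ1.le (by norm_num)
      have h2 : μ ^ 14 ≤ ν ^ 6 := by
        calc μ ^ 14 ≤ μ ^ 18 := pow_le_pow_right₀ hμ.le (by norm_num)
          _ = (μ ^ 3) ^ 6 := by ring
          _ ≤ ν ^ 6 := by gcongr
      calc δ ^ 24 * μ ^ 36 = δ ^ 24 * μ ^ 22 * μ ^ 14 := by ring
        _ ≤ _ := by gcongr
    calc _ ≤ _ := key
      _ = (Z.card : ℝ) * (4 * C₁ * 18 ^ 2 * μ ^ 13 * ν ^ 12 +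
            (W.card : ℝ) ^ 2 * (4 * 18 * 20 * μ ^ 12 * ν ^ 6)) := by ring
      _ ≤ 40 * (δ ^ 12 * ν ^ 12) * (4 * C₁ * 18 ^ 2 * μ ^ 13 * ν ^ 12 +
            (40 * (δ ^ 12 * μ ^ 12)) ^ 2 * (4 * 18 * 20 * μ ^ 12 * ν ^ 6)) := by gcongr
      _ = 40 * (δ ^ 12 * ν ^ 12) * (4 * C₁ * 18 ^ 2 * (μ ^ 13) * ν ^ 12 +
            40 ^ 2 * (4 * 18 * 20) * (δ ^ 24 * μ ^ 36) * ν ^ 6) := by ring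
      _ ≤ 40 * (δ ^ 12 * ν ^ 12) * (4 * C₁ * 18 ^ 2 * (δ ^ 14 * μ ^ 22) * ν ^ 12 +
            40 ^ 2 * (4 * 18 * 20) * (δ ^ 14 * μ ^ 22 * ν ^ 6) * ν ^ 6) := by gcongr
      _ = c₁ * (δ ^ 13 * μ ^ 11 * ν ^ 12) ^ 2 := by rw [hc₁]; ring
      _ ≤ (1 + c₁) * (δ ^ 13 * μ ^ 11 * ν ^ 12) ^ 2 := by gcongr; linarith
  · -- The two ranges are comparable on a logarithmic scale, so that the loss `ν` in the number of
    -- representations as a product of four elements is harmless.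
    have key := norm_kernel_sum_pow_le_of_normBox hd (k := 4) (by norm_num) (B := 2 * C₂ * ν)
      hM1 hN1 hΔ1 W Z hW (fun z hz => (hZ z hz).1) hD (fun ζ => by
        refine (hpr (2 * ν ^ 12) (by linarith) Z hZX ζ).trans ?_
        have := hrpow2 ν hν0
        calc C₂ * (2 * ν ^ 12) ^ (1 / 12 : ℝ) ≤ C₂ * (2 * ν) := by gcongr
          _ = 2 * C₂ * ν := by ring) α β hα hβ
    refine fin (1 + c₂) (by linarith) (by linarith) ?_
    refine le_mul_of_pow_le_mul_pow (n := 8) (by norm_num) (by linarith) hY.le ?_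
    rw [hsN] at key
    have e1 : δ ^ 120 * μ ^ 85 * ν ^ 97 ≤ δ ^ 104 * μ ^ 88 * ν ^ 96 := by
      have h1 : δ ^ 120 ≤ δ ^ 104 := pow_le_pow_of_le_one hδ.le hδ1.le (by norm_num)
      calc δ ^ 120 * μ ^ 85 * ν ^ 97 = δ ^ 120 * μ ^ 85 * ν ^ 96 * ν := by ring
        _ ≤ δ ^ 104 * μ ^ 85 * ν ^ 96 * μ ^ 3 := by gcongr
        _ = _ := by ring
    have e2 : δ ^ 144 * μ ^ 108 * ν ^ 73 ≤ δ ^ 104 * μ ^ 88 * ν ^ 96 := by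
      have h1 : δ ^ 144 ≤ δ ^ 104 := pow_le_pow_of_le_one hδ.le hδ1.le (by norm_num)
      have h2 : μ ^ 20 ≤ ν ^ 23 := by
        calc μ ^ 20 ≤ ν ^ 20 := by gcongr
          _ ≤ ν ^ 23 := pow_le_pow_right₀ hν.le (by norm_num)
      calc δ ^ 144 * μ ^ 108 * ν ^ 73 = δ ^ 144 * μ ^ 88 * ν ^ 73 * μ ^ 20 := by ring
        _ ≤ δ ^ 104 * μ ^ 88 * ν ^ 73 * ν ^ 23 := by gcongr
        _ = _ := by ring
    calc _ ≤ _ := key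
      _ = (W.card : ℝ) ^ 6 * (Z.card : ℝ) ^ 4 * (2 * C₂ * ν) *
            (4 * C₁ * 3888 ^ 2 * μ ^ 13 * ν ^ 48 +
            (W.card : ℝ) ^ 2 * (4 * 3888 * 20 * μ ^ 12 * ν ^ 24)) := by ring
      _ ≤ (40 * (δ ^ 12 * μ ^ 12)) ^ 6 * (40 * (δ ^ 12 * ν ^ 12)) ^ 4 * (2 * C₂ * ν) *
            (4 * C₁ * 3888 ^ 2 * μ ^ 13 * ν ^ 48 +
            (40 * (δ ^ 12 * μ ^ 12)) ^ 2 * (4 * 3888 * 20 * μ ^ 12 * ν ^ 24)) := by gcongr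
      _ = 40 ^ 6 * 40 ^ 4 * (2 * C₂) * (4 * C₁ * 3888 ^ 2 * (δ ^ 120 * μ ^ 85 * ν ^ 97) +
            40 ^ 2 * (4 * 3888 * 20) * (δ ^ 144 * μ ^ 108 * ν ^ 73)) := by ring
      _ ≤ 40 ^ 6 * 40 ^ 4 * (2 * C₂) * (4 * C₁ * 3888 ^ 2 * (δ ^ 104 * μ ^ 88 * ν ^ 96) +
            40 ^ 2 * (4 * 3888 * 20) * (δ ^ 104 * μ ^ 88 * ν ^ 96)) := by gcongr
      _ = c₂ * (δ ^ 13 * μ ^ 11 * ν ^ 12) ^ 8 := by rw [hc₂]; ring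
      _ ≤ (1 + c₂) * (δ ^ 13 * μ ^ 11 * ν ^ 12) ^ 8 := by gcongr; linarith

/-- For admissible coefficients the bilinear form reduces to the kernel. -/
theorem bilinearSum_eq {d : ℤ} (hd : d = -1 ∨ d = 2) {f : ℕ} {M N Δ : ℝ} (hM : 1 < M)
    (α β : Zsqrtd d → ℂ) (hα : IsAdmissible f α)
    (W Z : Finset (Zsqrtd d))
    (hW : ∀ w, w ∈ W ↔ w ∈ normBox d M Δ ∧ IsPrimitiveElt w ∧ α w ≠ 0)
    (hZ : ∀ z, z ∈ Z ↔ z ∈ normBox d N Δ ∧ IsPrimitiveElt z ∧ β z ≠ 0) :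
    bilinearSum M N Δ α β =
      ∑ w ∈ W, ∑ z ∈ Z, α w * (gammaSymbol w 1 : ℂ) * β z * (kernel w z : ℂ) := by
  classical
  rw [bilinearSum]
  have hWsub : W ⊆ (normBox d M Δ).filter IsPrimitiveElt := fun w hw =>
    Finset.mem_filter.2 ⟨((hW w).1 hw).1, ((hW w).1 hw).2.1⟩
  have hZsub : Z ⊆ (normBox d N Δ).filter IsPrimitiveElt := fun z hz =>
    Finset.mem_filter.2 ⟨((hZ z).1 hz).1, ((hZ z).1 hz).2.1⟩
  rw [← Finset.sum_subset hWsub]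
  · refine Finset.sum_congr rfl fun w hw => ?_
    obtain ⟨h1, h2, h3⟩ := (hW w).1 hw
    have hwk : IsKernelElt w := ⟨h2, by
      have h4 : (0 : ℝ) < w.norm := by linarith [(mem_normBox.1 h1).2.2.1]
      exact_mod_cast h4, (hα w h2.1.ne_zero h3).2⟩
    rw [← Finset.sum_subset hZsub]
    · refine Finset.sum_congr rfl fun z _ => ?_
      rw [gammaSymbol_eq hd hwk z]
      push_cast
      ring
    · intro z hz hzZ
      obtain ⟨h5, h6⟩ := Finset.mem_filter.1 hz
      have h7 : β z = 0 := by
        by_contra h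
        exact hzZ ((hZ z).2 ⟨h5, h6, h⟩)
      rw [h7, mul_zero, zero_mul]
  · intro w hw hwW
    obtain ⟨h5, h6⟩ := Finset.mem_filter.1 hw
    have h7 : α w = 0 := by
      by_contra h
      exact hwW ((hW w).2 ⟨h5, h6, h⟩)
    exact Finset.sum_eq_zero fun z _ => by rw [h7, zero_mul, zero_mul]

end QuadBilinear

open QuadBilinear in
theorem mainTheorem6 (d₀ : ℤ) (hd₀ : d₀ = -1 ∨ d₀ = 2) (K : ℝ) :
    ∃ C : ℝ, 0 < C ∧
      ∀ (f : ℕ) (α β : Zsqrtd d₀ → ℂ),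
        (∀ w : Zsqrtd d₀, w ≠ 0 → ‖α w‖ ≤ K) →
        (∀ z : Zsqrtd d₀, z ≠ 0 → ‖β z‖ ≤ K) →
        QuadBilinear.IsAdmissible f α →
        QuadBilinear.IsAdmissible f β →
        ∀ M N Δ : ℝ, 1 < M → 1 < N → 0 < Δ → Δ < 1 → 1 ≤ Δ * M → 1 ≤ Δ * N →
          ‖QuadBilinear.bilinearSum M N Δ α β‖ ≤
            C * 2 ^ f * Δ ^ (-(11 / 12) : ℝ) *
              (M ^ (-(1 / 12) : ℝ) + N ^ (-(1 / 12) : ℝ)) * Δ ^ 2 * M * N := by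
  classical
  obtain ⟨C, hC, hbound⟩ := exists_norm_kernel_sum_le hd₀
  refine ⟨(|K| + 1) ^ 2 * C, by positivity, ?_⟩
  intro f α β hα hβ hfα hfβ M N Δ hM hN hΔ hΔ1 hΔM hΔN
  set k : ℝ := |K| + 1 with hk
  have hk0 : 0 < k := by positivity
  have hkC : (k : ℂ) ≠ 0 := by exact_mod_cast hk0.ne'
  -- Twelfth roots of the parameters.
  have hroot : ∀ x : ℝ, 0 < x → ∃ y : ℝ, 0 < y ∧ x = y ^ 12 := fun x hx =>
    ⟨x ^ ((12 : ℕ) : ℝ)⁻¹, by positivity, (Real.rpow_inv_natCast_pow hx.le (by norm_num)).symm⟩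
  obtain ⟨δ, hδ, rfl⟩ := hroot Δ hΔ
  obtain ⟨μ, hμ, rfl⟩ := hroot M (by linarith)
  obtain ⟨ν, hν, rfl⟩ := hroot N (by linarith)
  have hδ1 : δ < 1 := by
    by_contra! h
    exact absurd (one_le_pow₀ h) (not_le.2 hΔ1)
  have hμ1 : 1 < μ := by
    by_contra! h
    exact absurd (pow_le_one₀ hμ.le h) (not_le.2 hM)
  have hν1 : 1 < ν := by
    by_contra! h
    exact absurd (pow_le_one₀ hν.le h) (not_le.2 hN)
  have hδμ : 1 ≤ δ * μ := by
    by_contra! h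
    have h1 := pow_lt_one₀ (by positivity) h (n := 12) (by norm_num)
    rw [mul_pow] at h1
    exact absurd hΔM (not_le.2 h1)
  have hδν : 1 ≤ δ * ν := by
    by_contra! h
    have h1 := pow_lt_one₀ (by positivity) h (n := 12) (by norm_num)
    rw [mul_pow] at h1
    exact absurd hΔN (not_le.2 h1)
  let W := (normBox d₀ (μ ^ 12) (δ ^ 12)).filter fun w => IsPrimitiveElt w ∧ α w ≠ 0
  let Z := (normBox d₀ (ν ^ 12) (δ ^ 12)).filter fun z => IsPrimitiveElt z ∧ β z ≠ 0
  have elt : ∀ {γ : Zsqrtd d₀ → ℂ} {x : ℝ}, 1 < x → IsAdmissible f γ →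
      ∀ w ∈ (normBox d₀ x (δ ^ 12)).filter fun w => IsPrimitiveElt w ∧ γ w ≠ 0,
        w ∈ normBox d₀ x (δ ^ 12) ∧ IsKernelElt w ∧ AtMostPrimeFactors f w := by
    intro γ x hx hγ w hw
    obtain ⟨h1, h2, h3⟩ := Finset.mem_filter.1 hw
    have h4 := hγ w h2.1.ne_zero h3
    refine ⟨h1, ⟨h2, ?_, h4.2⟩, h4.1⟩
    have h5 : (0 : ℝ) < w.norm := by linarith [(mem_normBox.1 h1).2.2.1]
    exact_mod_cast h5
  have hWp := elt hM hfα
  have hZp := elt hN hfβ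
  have hkK : K ≤ k := by rw [hk]; linarith [le_abs_self K]
  have hα' : ∀ w ∈ W, ‖α w * (gammaSymbol w 1 : ℂ) / k‖ ≤ 1 := by
    intro w hw
    obtain ⟨-, h2, -⟩ := hWp w hw
    have h3 : ‖(gammaSymbol w 1 : ℂ)‖ ≤ 1 := by
      rw [Complex.norm_intCast]
      exact_mod_cast abs_gammaSymbol_one_le hd₀ h2
    rw [norm_div, norm_mul, Complex.norm_real, Real.norm_of_nonneg hk0.le, div_le_one hk0]
    have h4 := (hα w h2.primitive.1.ne_zero).trans hkK
    exact (mul_le_mul h4 h3 (norm_nonneg _) hk0.le).trans_eq (mul_one k)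
  have hβ' : ∀ z ∈ Z, ‖β z / k‖ ≤ 1 := by
    intro z hz
    obtain ⟨-, h2, -⟩ := hZp z hz
    rw [norm_div, Complex.norm_real, Real.norm_of_nonneg hk0.le, div_le_one hk0]
    exact (hβ z h2.primitive.1.ne_zero).trans hkK
  have hsum : bilinearSum (μ ^ 12) (ν ^ 12) (δ ^ 12) α β = (k : ℂ) ^ 2 *
      ∑ w ∈ W, ∑ z ∈ Z, α w * (gammaSymbol w 1 : ℂ) / k * (β z / k) * (kernel w z : ℂ) := by
    rw [bilinearSum_eq hd₀ hM α β hfα W Z (fun w => Finset.mem_filter)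
      (fun z => Finset.mem_filter), Finset.mul_sum]
    refine Finset.sum_congr rfl fun w _ => ?_
    rw [Finset.mul_sum]
    refine Finset.sum_congr rfl fun z _ => ?_
    field_simp
  have hneg : ∀ x : ℝ, 0 < x → (x ^ 12) ^ (-(1 / 12) : ℝ) = x⁻¹ := by
    intro x hx
    rw [← Real.rpow_natCast, ← Real.rpow_mul hx.le, ← Real.rpow_neg_one]
    norm_num
  have hneg11 : (δ ^ 12) ^ (-(11 / 12) : ℝ) = (δ ^ 11)⁻¹ := by
    rw [← Real.rpow_natCast, ← Real.rpow_mul hδ.le, ← Real.rpow_natCast, ← Real.rpow_neg hδ.le]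
    norm_num
  have hrhs : k ^ 2 * C * 2 ^ f * (δ ^ 12) ^ (-(11 / 12) : ℝ) *
      ((μ ^ 12) ^ (-(1 / 12) : ℝ) + (ν ^ 12) ^ (-(1 / 12) : ℝ)) * (δ ^ 12) ^ 2 * μ ^ 12 * ν ^ 12 =
      k ^ 2 * (C * 2 ^ f * (δ ^ 13 * μ ^ 11 * ν ^ 12) +
        C * 2 ^ f * (δ ^ 13 * ν ^ 11 * μ ^ 12)) := by
    rw [hneg μ hμ, hneg ν hν, hneg11]
    field_simp
  rw [hrhs, hsum, norm_mul, norm_pow, Complex.norm_real, Real.norm_of_nonneg hk0.le]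
  refine mul_le_mul_of_nonneg_left ?_ (by positivity)
  rcases le_total μ ν with hle | hle
  · refine (hbound f δ μ ν hδ hδ1 hμ1 hle hδμ W Z (fun w hw => ⟨(hWp w hw).1, (hWp w hw).2.1⟩) hZp
      _ _ hα' hβ').trans (le_add_of_nonneg_right (by positivity))
  · -- The kernel is symmetric, so the roles of `w` and `z` may be exchanged.
    have hswap : ∑ w ∈ W, ∑ z ∈ Z,
        α w * (gammaSymbol w 1 : ℂ) / k * (β z / k) * (kernel w z : ℂ) =
        ∑ z ∈ Z, ∑ w ∈ W,
          β z / k * (α w * (gammaSymbol w 1 : ℂ) / k) * (kernel z w : ℂ) := by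
      rw [Finset.sum_comm]
      refine Finset.sum_congr rfl fun z hz => Finset.sum_congr rfl fun w hw => ?_
      rw [kernel_comm (hWp w hw).2.1 (hZp z hz).2.1]
      ring
    rw [hswap]
    exact (hbound f δ ν μ hδ hδ1 hν1 hle hδν Z W (fun z hz => ⟨(hZp z hz).1, (hZp z hz).2.1⟩) hWp
      (fun z => β z / k) (fun w => α w * (gammaSymbol w 1 : ℂ) / k) hβ' hα').trans
      (le_add_of_nonneg_left (by positivity))
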